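/- For complex $a,b$ let $W_{a,b}$ denote the Whittaker function on $(0,\infty)$, i.e. the solution $w$ of Whittaker's equation $$w''(x)+\Bigl\{-\tfrac14+\tfrac{a}{x}+\tfrac{1/4-b^2}{x^2}\Bigr\}w(x)=0,\qquad x>0,$$ with $w(x)\sim x^{a}e^{-x/2}$ as $x\to+\infty$. For $x>0$ let $E_1(x)=\int_x^\infty \frac{e^{-y}}{y}\,dy$ be the exponential integral and let $$G(x)=G^{3,1}_{2,3}\Bigl(x\,\Big|\,{0,1\atop 0,0,0}\Bigr)=\frac1{2\pi i}\int_{\sigma-i\infty}^{\sigma+i\infty}\frac{\Gamma(-s)^3\,\Gamma(1+s)}{\Gamma(1-s)}\,x^s\,ds\qquad(-1<\sigma<0)$$ be the indicated Meijer $G$-function. Then for every fixed $x>0$ the function $b\mapsto W_{1,b}(x)$ of the complex variable $b$ is three times continuously differentiable at $b=\tfrac12$, and (a) $\displaystyle \frac{\partial}{\partial b}W_{1,b}(x)\Big|_{b=1/2}=e^{-x/2}$; (b) $\displaystyle \frac{\partial^2}{\partial b^2}W_{1,b}(x)\Big|_{b=1/2}=2e^{-x/2}\bigl\{e^{x}E_1(x)+x\,G(x)\bigr\}$;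 (c) $\displaystyle \frac{\partial^3}{\partial b^3}W_{1,b}(x)\Big|_{b=1/2}=6e^{-x/2}G(x)$. Moreover $\displaystyle G(x)=\int_0^\infty e^{-xy}\log(1+y)\,\frac{dy}{y}$, where the integral converges absolutely. -/

import Mathlib

/-- `IsWhittakerW a b w`: on the half-line `x > 0` the function `w` solves Whittaker's equation
`w'' + (-1/4 + a / x + (1/4 - b ^ 2) / x ^ 2) w = 0` and satisfies `w x ~ x ^ a * exp (-x / 2)` as
`x → +∞`. These two properties determine the values of `w` on `x > 0` (a second independent solution
grows like `x ^ (-a) * exp (x / 2)`), and they are the usual normalization of the Whittaker function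
`W_{a,b}`. -/
def IsWhittakerW (a b : ℂ) (w : ℝ → ℂ) : Prop :=
  (∃ w' : ℝ → ℂ, ∀ x : ℝ, 0 < x →
    HasDerivAt w (w' x) x ∧
    HasDerivAt w' (-(-1 / 4 + a / (x : ℂ) + (1 / 4 - b ^ 2) / (x : ℂ) ^ 2) * w x) x) ∧
  Asymptotics.IsEquivalent Filter.atTop w (fun x : ℝ => (x : ℂ) ^ a * Complex.exp (-(x : ℂ) / 2))

open Classical in
/-- The Whittaker function `W_{a,b}(x)` for complex parameters `a`, `b` and real `x > 0`: the solution
of Whittaker's equation that is asymptotic to `x ^ a * exp (-x / 2)` as `x → +∞`. -/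
noncomputable def whittakerW (a b : ℂ) (x : ℝ) : ℂ :=
  if h : ∃ w : ℝ → ℂ, IsWhittakerW a b w then h.choose x else 0

/-- The exponential integral `E₁(x) = ∫_x^∞ exp (-y) / y dy` for `x > 0`. -/
noncomputable def expIntegralE1 (x : ℝ) : ℝ :=
  ∫ y in Set.Ioi x, Real.exp (-y) / y

/-- The integrand of the Mellin-Barnes integral for `G^{m,n}_{p,q}(z | a; b)`. The indices
`1, …, m` of `b` are the `k : Fin q` with `k < m`, and the indices `1, …, n` of `a` are the
`j : Fin p` with `j < n`. -/
noncomputable def meijerIntegrand {p q : ℕ} (m n : ℕ) (a : Fin p → ℂ) (b : Fin q → ℂ) (z s : ℂ) : ℂ :=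
  ((∏ k : Fin q with k.val < m, Complex.Gamma (b k - s)) *
      (∏ j : Fin p with j.val < n, Complex.Gamma (1 - a j + s))) /
    ((∏ k : Fin q with m ≤ k.val, Complex.Gamma (1 - b k + s)) *
      (∏ j : Fin p with n ≤ j.val, Complex.Gamma (a j - s))) * z ^ s

/-- The vertical line `Re s = σ` separates the poles of `Γ(b_k - s)`, `k ≤ m` (to its right), from
those of `Γ(1 - a_j + s)`, `j ≤ n` (to its left). -/
def IsMeijerAbscissa {p q : ℕ} (m n : ℕ) (a : Fin p → ℂ) (b : Fin q → ℂ) (σ : ℝ) : Prop :=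
  (∀ k : Fin q, (k : ℕ) < m → σ < (b k).re) ∧ (∀ j : Fin p, (j : ℕ) < n → (a j).re - 1 < σ)

open Classical in
/-- The Meijer function `G^{m,n}_{p,q}(z | a; b)`, for parameters whose two families of poles can be
separated by a vertical line: `(2 π i)⁻¹` times the Mellin-Barnes integral along such a line
`s = σ + i t`, traversed upwards. (For other parameters, which need a bent contour, the value
is set to `0`.) -/
noncomputable def meijerG {p q : ℕ} (m n : ℕ) (a : Fin p → ℂ) (b : Fin q → ℂ) (z : ℂ) : ℂ :=
  if h : ∃ σ : ℝ, IsMeijerAbscissa m n a b σ then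
    1 / (2 * (Real.pi : ℂ) * Complex.I) *
      ∫ t : ℝ, meijerIntegrand m n a b z ((h.choose : ℂ) + (t : ℂ) * Complex.I) * Complex.I
  else 0

/-! Whittaker's equation depends on `b` only through `λ = b ^ 2 - 1 / 4`. With `w = exp (-x / 2) *
u` and `a = 1` it becomes `u'' - u' + u / x = λ * u / x ^ 2`, so a power series `u = ∑ λ ^ n * u_n`
must satisfy `u_n'' - u_n' + u_n / x = u_{n-1} / x ^ 2`. One takes `u_0 = x`, `u_1 = 1`, and
explicit `u_2`, `u_3` built from `exp x * E₁(x)` and the Laplace transform `L` of `log (1 + y) / y`.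
From `u_4` on, the solution decaying at infinity is obtained by reduction of order. Each such step
gains a factor that forces factorial decay (`higherCoeff_spec`), so the series is entire in `λ`, can
be differentiated termwise in `x`, and is asymptotic to `x`.

The normalized solution is unique: a nonzero Wronskian would make the quotient of two such solutions
grow without bound (`IsWhittakerW.unique`). Hence the series is `W_{1,b}`, and with `t = b - 1 / 2`,
`λ = t + t ^ 2`, the derivatives at `b = 1 / 2` are read off from the expansion to order `t ^ 3`.

Finally `L` is the Meijer function: its Mellin transform on `0 < Re s < 1` is `Γ(s) ^ 2 * Γ(1 - s) /
s`, which decays fast enough on vertical lines for Mellin inversion (`meijerG_eq_laplaceLogDiv`). -/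

open MeasureTheory Set Filter Topology

/-! ### The exponential integral and the Laplace transform of `log (1 + y) / y` -/

theorem hasDerivAt_integral_Ioi_lower {f : ℝ → ℝ} (hf : ContinuousOn f (Ioi 0))
    (hint : ∀ x, 0 < x → IntegrableOn f (Ioi x)) {x : ℝ} (hx : 0 < x) :
    HasDerivAt (fun z => ∫ y in Ioi z, f y) (-f x) x := by
  have h2 : 0 < x / 2 := by positivity
  have hI : HasDerivAt (fun z => ∫ y in (x / 2)..z, f y) (f x) x := by
    refine intervalIntegral.integral_hasDerivAt_right ?_ ?_ (hf.continuousAt (Ioi_mem_nhds hx))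
    · refine (hf.mono fun y hy => ?_).intervalIntegrable
      rw [uIcc_of_le (by linarith)] at hy
      exact h2.trans_le hy.1
    · exact hf.stronglyMeasurableAtFilter isOpen_Ioi x hx
  have h := (hasDerivAt_const x (∫ y in Ioi (x / 2), f y)).sub hI
  rw [zero_sub] at h
  refine h.congr_of_eventuallyEq ?_
  filter_upwards [Ioi_mem_nhds (show x / 2 < x by linarith)] with z hz
  have := intervalIntegral.integral_interval_add_Ioi (hint _ h2) (hint z (h2.trans hz))
  simp only [Pi.sub_apply]
  linarith

theorem integrableOn_Ioi_of_le_exp {f : ℝ → ℝ} (hf : ContinuousOn f (Ioi 0)) {x c C : ℝ} (hx : 0 ≤ x)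
    (hc : 0 < c) (hb : ∀ y, x < y → |f y| ≤ C * Real.exp (-(c * y))) :
    IntegrableOn f (Ioi x) := by
  have h : IntegrableOn (fun y => C * Real.exp (-c * y)) (Ioi x) :=
    (integrableOn_exp_mul_Ioi (neg_neg_of_pos hc) x).const_mul C
  refine Integrable.mono' h ((hf.mono (Ioi_subset_Ioi hx)).aestronglyMeasurable measurableSet_Ioi) ?_
  filter_upwards [ae_restrict_mem measurableSet_Ioi] with y hy
  rw [Real.norm_eq_abs]
  simpa using hb y hy

theorem integral_Ioi_exp_neg_mul {x : ℝ} (hx : 0 < x) :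
    ∫ y in Ioi (0 : ℝ), Real.exp (-(x * y)) = 1 / x := by
  have h := integral_exp_mul_Ioi (neg_neg_of_pos hx) 0
  simp only [neg_mul] at h
  rw [h]; simp

theorem integrableOn_Ioi_exp_neg_mul {x : ℝ} (hx : 0 < x) :
    IntegrableOn (fun y => Real.exp (-(x * y))) (Ioi 0) := by
  simpa using integrableOn_exp_mul_Ioi (neg_neg_of_pos hx) 0

theorem integral_Ioi_mul_exp_neg_mul {x : ℝ} (hx : 0 < x) :
    ∫ y in Ioi (0 : ℝ), y * Real.exp (-(x * y)) = 1 / x ^ 2 := by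
  have h := Real.integral_rpow_mul_exp_neg_mul_Ioi (a := 2) two_pos hx
  norm_num at h
  rw [h]; simp

theorem integrableOn_Ioi_mul_exp_neg_mul {x : ℝ} (hx : 0 < x) :
    IntegrableOn (fun y => y * Real.exp (-(x * y))) (Ioi 0) := by
  -- A non-integrable function has integral 0 by convention, but the value here is positive.
  by_contra h
  have h1 := integral_Ioi_mul_exp_neg_mul hx
  rw [integral_undef h] at h1
  have : 0 < 1 / x ^ 2 := by positivity
  linarith

theorem log_one_add_le_self {y : ℝ} (hy : 0 < y) : Real.log (1 + y) ≤ y := by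
  have := Real.log_le_sub_one_of_pos (show 0 < 1 + y by linarith)
  linarith

theorem log_one_add_div_bounds {y : ℝ} (hy : 0 < y) :
    1 - y ≤ Real.log (1 + y) / y ∧ Real.log (1 + y) / y ≤ 1 ∧ 0 ≤ Real.log (1 + y) / y := by
  have hy1 : 0 < 1 + y := by linarith
  refine ⟨?_, ?_, div_nonneg (Real.log_nonneg (by linarith)) hy.le⟩
  · rw [le_div_iff₀ hy]
    have h := Real.one_sub_inv_le_log_of_pos hy1
    refine le_trans ?_ h
    have : (1 + y)⁻¹ ≤ 1 - y + y * y := by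
      rw [inv_le_iff_one_le_mul₀ hy1]; nlinarith [pow_pos hy 3]
    linarith
  · rw [div_le_one hy]
    exact log_one_add_le_self hy

theorem continuousOn_log_one_add : ContinuousOn (fun y : ℝ => Real.log (1 + y)) (Ioi 0) := by
  refine ContinuousOn.log (by fun_prop) fun y hy => ?_
  have : (0 : ℝ) < y := hy
  positivity

theorem continuousOn_log_one_add_div :
    ContinuousOn (fun y : ℝ => Real.log (1 + y) / y) (Ioi 0) :=
  continuousOn_log_one_add.div continuousOn_id fun _ hy => (ne_of_gt hy)

theorem integrableOn_exp_mul_log_div {x : ℝ} (hx : 0 < x) :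
    IntegrableOn (fun y : ℝ => Real.exp (-(x * y)) * Real.log (1 + y) / y) (Ioi 0) := by
  refine integrableOn_Ioi_of_le_exp (C := 1) (c := x) ?_ le_rfl hx fun y hy => ?_
  · have : Continuous fun y : ℝ => Real.exp (-(x * y)) := by fun_prop
    simpa only [mul_div_assoc] using this.continuousOn.fun_mul continuousOn_log_one_add_div
  · obtain ⟨-, h1, h2⟩ := log_one_add_div_bounds hy
    rw [mul_div_assoc, abs_of_nonneg (by positivity), one_mul]
    exact mul_le_of_le_one_right (by positivity) h1

theorem integrableOn_exp_mul_log {x : ℝ} (hx : 0 < x) :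
    IntegrableOn (fun y : ℝ => Real.exp (-(x * y)) * Real.log (1 + y)) (Ioi 0) := by
  refine Integrable.mono' (integrableOn_Ioi_mul_exp_neg_mul hx) ?_ ?_
  · have : Continuous fun y : ℝ => Real.exp (-(x * y)) := by fun_prop
    exact (this.continuousOn.mul continuousOn_log_one_add).aestronglyMeasurable measurableSet_Ioi
  · filter_upwards [ae_restrict_mem measurableSet_Ioi] with y hy
    have hy : 0 < y := hy
    rw [Real.norm_eq_abs, abs_of_nonneg (mul_nonneg (by positivity)
      (Real.log_nonneg (by linarith))), mul_comm]
    exact mul_le_mul_of_nonneg_right (log_one_add_le_self hy) (by positivity)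

/-- The Laplace transform of `log (1 + y) / y`. -/
noncomputable def laplaceLogDiv (x : ℝ) : ℝ :=
  ∫ y in Ioi (0 : ℝ), Real.exp (-(x * y)) * Real.log (1 + y) / y

theorem laplaceLogDiv_nonneg (x : ℝ) : 0 ≤ laplaceLogDiv x := by
  refine setIntegral_nonneg measurableSet_Ioi fun y hy => ?_
  rw [mul_div_assoc]
  exact mul_nonneg (by positivity) (log_one_add_div_bounds hy).2.2

theorem laplaceLogDiv_le {x : ℝ} (hx : 0 < x) : laplaceLogDiv x ≤ 1 / x := by
  rw [← integral_Ioi_exp_neg_mul hx]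
  refine setIntegral_mono_on (integrableOn_exp_mul_log_div hx) (integrableOn_Ioi_exp_neg_mul hx)
    measurableSet_Ioi fun y hy => ?_
  rw [mul_div_assoc]
  exact mul_le_of_le_one_right (by positivity) (log_one_add_div_bounds hy).2.1

/-- Together with the upper bound `1 / x` this gives `x * L(x) = 1 + O(1 / x)`, which is what makes
`coeffTwo` decay. -/
theorem sub_le_laplaceLogDiv {x : ℝ} (hx : 0 < x) : 1 / x - 1 / x ^ 2 ≤ laplaceLogDiv x := by
  rw [← integral_Ioi_exp_neg_mul hx, ← integral_Ioi_mul_exp_neg_mul hx,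
    ← integral_sub (integrableOn_Ioi_exp_neg_mul hx) (integrableOn_Ioi_mul_exp_neg_mul hx)]
  refine setIntegral_mono_on ((integrableOn_Ioi_exp_neg_mul hx).sub
    (integrableOn_Ioi_mul_exp_neg_mul hx)) (integrableOn_exp_mul_log_div hx)
    measurableSet_Ioi fun y hy => ?_
  rw [mul_div_assoc]
  have := mul_le_mul_of_nonneg_left (log_one_add_div_bounds hy).1 (Real.exp_pos (-(x * y))).le
  linarith

theorem hasDerivAt_laplaceLogDiv_aux {x : ℝ} (hx : 0 < x) :
    HasDerivAt laplaceLogDiv (∫ y in Ioi (0 : ℝ), -(Real.exp (-(x * y)) * Real.log (1 + y))) x := by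
  have h2 : 0 < x / 2 := by positivity
  refine (hasDerivAt_integral_of_dominated_loc_of_deriv_le
    (F := fun x y => Real.exp (-(x * y)) * Real.log (1 + y) / y)
    (F' := fun x y => -(Real.exp (-(x * y)) * Real.log (1 + y)))
    (bound := fun y => Real.exp (-(x / 2 * y)) * Real.log (1 + y))
    (Ioi_mem_nhds (show x / 2 < x by linarith)) ?_ (integrableOn_exp_mul_log_div hx)
    (integrableOn_exp_mul_log hx).neg.aestronglyMeasurable ?_ (integrableOn_exp_mul_log h2) ?_).2
  · filter_upwards [Ioi_mem_nhds hx] with z hz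
    exact (integrableOn_exp_mul_log_div hz).aestronglyMeasurable
  · filter_upwards [ae_restrict_mem measurableSet_Ioi] with y hy z hz
    have hy : 0 < y := hy
    have hz : x / 2 < z := hz
    have hl : 0 ≤ Real.log (1 + y) := Real.log_nonneg (by linarith)
    rw [norm_neg, Real.norm_eq_abs, abs_of_nonneg (by positivity)]
    gcongr
  · filter_upwards [ae_restrict_mem measurableSet_Ioi] with y hy z hz
    have hy : y ≠ 0 := (ne_of_gt hy)
    have h := ((((hasDerivAt_id z).mul_const y).neg.exp).mul_const (Real.log (1 + y))).div_const y
    refine h.congr_deriv ?_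
    simp only [id, Pi.neg_apply]
    field_simp

theorem continuousOn_exp_neg_div : ContinuousOn (fun y : ℝ => Real.exp (-y) / y) (Ioi 0) :=
  ContinuousOn.div (by fun_prop) continuousOn_id fun _ hy => (ne_of_gt hy)

theorem integrableOn_exp_neg_div {x : ℝ} (hx : 0 < x) :
    IntegrableOn (fun y : ℝ => Real.exp (-y) / y) (Ioi x) := by
  refine integrableOn_Ioi_of_le_exp (C := 1 / x) (c := 1) continuousOn_exp_neg_div hx.le one_pos
    fun y hy => ?_
  have hy0 : 0 < y := hx.trans hy
  rw [abs_of_nonneg (by positivity), one_mul, div_eq_mul_one_div, mul_comm]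
  gcongr

/-- Substitute `z = 1 + y`, then rescale by `x`. -/
theorem integral_exp_mul_inv_one_add {x : ℝ} (hx : 0 < x) :
    ∫ y in Ioi (0 : ℝ), Real.exp (-(x * y)) / (1 + y) = Real.exp x * expIntegralE1 x := by
  have h1 : ∫ y in Ioi (0 : ℝ), Real.exp (-(x * y)) / (1 + y)
      = ∫ y in Ioi (0 : ℝ), (fun z => Real.exp (-(x * (z - 1))) / z) (y + 1) := by
    refine setIntegral_congr_fun measurableSet_Ioi fun y _ => ?_
    simp [add_comm]
  have h2 := (measurePreserving_add_right volume (1 : ℝ)).setIntegral_preimage_emb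
    (measurableEmbedding_addRight 1) (fun z => Real.exp (-(x * (z - 1))) / z) (Ioi 1)
  have h3 : (fun y : ℝ => y + 1) ⁻¹' Ioi 1 = Ioi 0 := by ext y; simp
  rw [h3] at h2
  rw [h1, h2, expIntegralE1, ← mul_one x, ← integral_comp_mul_left_Ioi' _ _ hx, mul_one, smul_eq_mul,
    ← integral_const_mul, ← integral_const_mul]
  refine setIntegral_congr_fun measurableSet_Ioi fun y hy => ?_
  have hy : (0 : ℝ) < y := one_pos.trans hy
  have : Real.exp (-(x * (y - 1))) = Real.exp x * Real.exp (-(x * y)) := by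
    rw [← Real.exp_add]; ring_nf
  simp only [this]
  field_simp

/-- The function `exp x * E₁(x)`. -/
noncomputable def expMulE1 (x : ℝ) : ℝ := Real.exp x * expIntegralE1 x

theorem hasDerivAt_expMulE1 {x : ℝ} (hx : 0 < x) :
    HasDerivAt expMulE1 (expMulE1 x - 1 / x) x := by
  have h := (Real.hasDerivAt_exp x).mul
    (hasDerivAt_integral_Ioi_lower continuousOn_exp_neg_div (fun _ => integrableOn_exp_neg_div) hx)
  refine h.congr_deriv ?_
  have : Real.exp x * Real.exp (-x) = 1 := by rw [← Real.exp_add]; simp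
  simp only [expMulE1, expIntegralE1]
  field_simp
  linear_combination -this

theorem integrableOn_exp_mul_inv_one_add {x : ℝ} (hx : 0 < x) :
    IntegrableOn (fun y : ℝ => Real.exp (-(x * y)) / (1 + y)) (Ioi 0) := by
  refine integrableOn_Ioi_of_le_exp (C := 1) (c := x) ?_ le_rfl hx fun y hy => ?_
  · refine ContinuousOn.div (by fun_prop) (by fun_prop) fun y hy => ?_
    have : (0 : ℝ) < y := hy
    positivity
  · rw [abs_of_nonneg (by positivity), one_mul]
    exact div_le_self (by positivity) (by linarith)

theorem expMulE1_nonneg {x : ℝ} (hx : 0 < x) : 0 ≤ expMulE1 x := by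
  rw [expMulE1, ← integral_exp_mul_inv_one_add hx]
  refine setIntegral_nonneg measurableSet_Ioi fun y hy => ?_
  have : (0 : ℝ) < y := hy
  positivity

theorem expMulE1_le {x : ℝ} (hx : 0 < x) : expMulE1 x ≤ 1 / x := by
  rw [expMulE1, ← integral_exp_mul_inv_one_add hx, ← integral_Ioi_exp_neg_mul hx]
  refine setIntegral_mono_on (integrableOn_exp_mul_inv_one_add hx)
    (integrableOn_Ioi_exp_neg_mul hx) measurableSet_Ioi fun y hy => ?_
  have : (0 : ℝ) < y := hy
  exact div_le_self (by positivity) (by linarith)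

/-- Integration by parts: the boundary terms vanish at 0 and at infinity, leaving the integral for
`exp x * E₁(x)`. -/
theorem integral_exp_mul_log {x : ℝ} (hx : 0 < x) :
    ∫ y in Ioi (0 : ℝ), Real.exp (-(x * y)) * Real.log (1 + y) = expMulE1 x / x := by
  have hd : ∀ y ∈ Ici (0 : ℝ), HasDerivAt (fun y => Real.exp (-(x * y)) * Real.log (1 + y))
      (Real.exp (-(x * y)) / (1 + y) - x * (Real.exp (-(x * y)) * Real.log (1 + y))) y := by
    intro y hy
    have hy : 0 ≤ y := hy
    have h1 : HasDerivAt (fun y : ℝ => Real.exp (-(x * y))) (Real.exp (-(x * y)) * -(x * 1)) y :=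
      ((hasDerivAt_id y).const_mul x).neg.exp
    have h2 : HasDerivAt (fun y : ℝ => Real.log (1 + y)) (1 / (1 + y)) y :=
      ((hasDerivAt_id y).const_add 1).log (by simp only [id]; positivity)
    exact (h1.mul h2).congr_deriv (by ring)
  have ht : Tendsto (fun y => Real.exp (-(x * y)) * Real.log (1 + y)) atTop (𝓝 0) := by
    have h0 : Tendsto (fun y : ℝ => y * Real.exp (-(x * y))) atTop (𝓝 0) := by
      have := (Real.tendsto_pow_mul_exp_neg_atTop_nhds_zero 1).comp
        (tendsto_id.const_mul_atTop hx)
      have := this.const_mul (1 / x)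
      rw [mul_zero] at this
      refine this.congr fun y => ?_
      simp only [Function.comp, id, pow_one]
      field_simp
    refine squeeze_zero' ?_ ?_ h0
    · filter_upwards [eventually_gt_atTop 0] with y hy
      exact mul_nonneg (by positivity) (Real.log_nonneg (by linarith))
    · filter_upwards [eventually_gt_atTop 0] with y hy
      rw [mul_comm]
      exact mul_le_mul_of_nonneg_right (log_one_add_le_self hy) (by positivity)
  have h := integral_Ioi_of_hasDerivAt_of_tendsto' hd
    ((integrableOn_exp_mul_inv_one_add hx).sub ((integrableOn_exp_mul_log hx).const_mul x)) ht
  rw [integral_sub (integrableOn_exp_mul_inv_one_add hx) ((integrableOn_exp_mul_log hx).const_mul x),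
    integral_exp_mul_inv_one_add hx, integral_const_mul] at h
  simp only [add_zero, Real.log_one, mul_zero, sub_zero] at h
  rw [eq_div_iff hx.ne', expMulE1]
  linarith

theorem hasDerivAt_laplaceLogDiv {x : ℝ} (hx : 0 < x) :
    HasDerivAt laplaceLogDiv (-(expMulE1 x / x)) x := by
  have := hasDerivAt_laplaceLogDiv_aux hx
  rwa [integral_neg, integral_exp_mul_log hx] at this

/-! ### The decaying solution of the inhomogeneous equation -/

theorem hasDerivAt_inv_pow_div {m : ℕ} {z : ℝ} (hz : 0 < z) :
    HasDerivAt (fun z : ℝ => -(1 / ((m + 1) * z ^ (m + 1)))) (1 / z ^ (m + 2)) z := by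
  have h1 : HasDerivAt (fun z : ℝ => (m + 1 : ℝ) * z ^ (m + 1)) ((m + 1) * (((m + 1 : ℕ) : ℝ) * z ^ m)) z :=
    (hasDerivAt_pow (m + 1) z).const_mul _
  have h2 := (h1.fun_inv (by positivity)).neg
  simp only [one_div]
  refine h2.congr_deriv ?_
  push_cast
  field_simp
  ring

theorem tendsto_inv_pow_div (m : ℕ) :
    Tendsto (fun z : ℝ => -(1 / (((m : ℝ) + 1) * z ^ (m + 1)))) atTop (𝓝 0) := by
  rw [← neg_zero]
  refine Tendsto.neg (tendsto_const_nhds.div_atTop ?_)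
  exact (tendsto_pow_atTop (by omega)).const_mul_atTop (by positivity)

theorem integrableOn_Ioi_inv_pow (m : ℕ) {x : ℝ} (hx : 0 < x) :
    IntegrableOn (fun z : ℝ => 1 / z ^ (m + 2)) (Ioi x) :=
  integrableOn_Ioi_deriv_of_nonneg' (fun _ hz => hasDerivAt_inv_pow_div (hx.trans_le hz))
    (fun z hz => by have : 0 < z := hx.trans hz; positivity) (tendsto_inv_pow_div m)

theorem integral_Ioi_inv_pow (m : ℕ) {x : ℝ} (hx : 0 < x) :
    ∫ z in Ioi x, 1 / z ^ (m + 2) = 1 / ((m + 1) * x ^ (m + 1)) := by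
  rw [integral_Ioi_of_hasDerivAt_of_nonneg' (fun _ hz => hasDerivAt_inv_pow_div (hx.trans_le hz))
    (fun z hz => by have : 0 < z := hx.trans hz; positivity) (tendsto_inv_pow_div m)]
  ring

/-- Minus the derivative of `recessiveT f x / x`. -/
noncomputable def recessiveP (f : ℝ → ℝ) (x : ℝ) : ℝ :=
  Real.exp x / x ^ 2 * ∫ y in Ioi x, f y * Real.exp (-y) / y

/-- The solution `u` of `u'' - u' + u / x = f / x ^ 2` that is recessive at `+∞`. -/
noncomputable def recessiveT (f : ℝ → ℝ) (x : ℝ) : ℝ := x * ∫ z in Ioi x, recessiveP f z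

/-- The derivative of `recessiveT f`. -/
noncomputable def recessiveTDeriv (f : ℝ → ℝ) (x : ℝ) : ℝ :=
  (∫ z in Ioi x, recessiveP f z) - x * recessiveP f x

section Recessive

variable {f : ℝ → ℝ} {C : ℝ} {k : ℕ}

theorem integrand_bound (hb : ∀ y, 0 < y → |f y| ≤ C / y ^ k) (hC : 0 ≤ C) {x y : ℝ} (hx : 0 < x)
    (hy : x < y) : |f y * Real.exp (-y) / y| ≤ C / x ^ (k + 1) * Real.exp (-y) := by
  have hy0 : 0 < y := hx.trans hy
  rw [abs_div, abs_mul, abs_of_pos hy0, abs_of_pos (Real.exp_pos _)]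
  have h1 : |f y| * Real.exp (-y) / y = |f y| / y * Real.exp (-y) := by ring
  rw [h1]
  refine mul_le_mul_of_nonneg_right ?_ (Real.exp_pos _).le
  calc |f y| / y ≤ C / y ^ k / y := by gcongr; exact hb y hy0
    _ = C / y ^ (k + 1) := by rw [div_div, pow_succ]
    _ ≤ C / x ^ (k + 1) := by gcongr

theorem continuousOn_integrand (hf : ContinuousOn f (Ioi 0)) :
    ContinuousOn (fun y => f y * Real.exp (-y) / y) (Ioi 0) :=
  (hf.mul (by fun_prop)).div continuousOn_id fun _ hy => (ne_of_gt hy)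

theorem integrableOn_integrand (hf : ContinuousOn f (Ioi 0))
    (hb : ∀ y, 0 < y → |f y| ≤ C / y ^ k) (hC : 0 ≤ C) {x : ℝ} (hx : 0 < x) :
    IntegrableOn (fun y => f y * Real.exp (-y) / y) (Ioi x) :=
  integrableOn_Ioi_of_le_exp (C := C / x ^ (k + 1)) (c := 1) (continuousOn_integrand hf) hx.le one_pos
    fun y hy => by rw [one_mul]; exact integrand_bound hb hC hx hy

theorem abs_recessiveP_le (hb : ∀ y, 0 < y → |f y| ≤ C / y ^ k) (hC : 0 ≤ C) {x : ℝ} (hx : 0 < x) :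
    |recessiveP f x| ≤ C / x ^ (k + 3) := by
  have h1 : |∫ y in Ioi x, f y * Real.exp (-y) / y| ≤ C / x ^ (k + 1) * Real.exp (-x) := by
    rw [← integral_exp_neg_Ioi, ← integral_const_mul, ← Real.norm_eq_abs]
    refine norm_integral_le_of_norm_le ?_ ?_
    · have := (integrableOn_exp_mul_Ioi (neg_one_lt_zero (R := ℝ)) x).const_mul (C / x ^ (k + 1))
      simpa using this
    · filter_upwards [ae_restrict_mem measurableSet_Ioi] with y hy
      exact integrand_bound hb hC hx hy
  rw [recessiveP, abs_mul, abs_of_pos (show 0 < Real.exp x / x ^ 2 by positivity)]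
  calc _ ≤ Real.exp x / x ^ 2 * (C / x ^ (k + 1) * Real.exp (-x)) := by gcongr
    _ = (Real.exp x * Real.exp (-x)) * (C / x ^ (k + 3)) := by
      field_simp; ring
    _ = C / x ^ (k + 3) := by rw [← Real.exp_add]; simp

/-- Reduction of order with the homogeneous solution `x`: for `u = x * v` and `p = -v'`, the
equation `u'' - u' + u / x = f / x ^ 2` becomes this first-order equation for `p`, with integrating
factor `x ^ 2 * exp (-x)`. -/
theorem hasDerivAt_recessiveP (hf : ContinuousOn f (Ioi 0))
    (hb : ∀ y, 0 < y → |f y| ≤ C / y ^ k) (hC : 0 ≤ C) {x : ℝ} (hx : 0 < x) :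
    HasDerivAt (recessiveP f) (recessiveP f x - 2 * recessiveP f x / x - f x / x ^ 3) x := by
  have h1 := hasDerivAt_integral_Ioi_lower (continuousOn_integrand hf)
    (fun _ => integrableOn_integrand hf hb hC) hx
  have h2 := ((Real.hasDerivAt_exp x).fun_div (hasDerivAt_pow 2 x) (by positivity)).fun_mul h1
  refine h2.congr_deriv ?_
  have : Real.exp x * Real.exp (-x) = 1 := by rw [← Real.exp_add]; simp
  simp only [recessiveP]
  field_simp
  push_cast
  linear_combination (-(x * f x)) * this

theorem continuousOn_recessiveP (hf : ContinuousOn f (Ioi 0))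
    (hb : ∀ y, 0 < y → |f y| ≤ C / y ^ k) (hC : 0 ≤ C) : ContinuousOn (recessiveP f) (Ioi 0) :=
  fun _ hx => (hasDerivAt_recessiveP hf hb hC hx).continuousAt.continuousWithinAt

theorem integrableOn_recessiveP (hf : ContinuousOn f (Ioi 0))
    (hb : ∀ y, 0 < y → |f y| ≤ C / y ^ k) (hC : 0 ≤ C) {x : ℝ} (hx : 0 < x) :
    IntegrableOn (recessiveP f) (Ioi x) := by
  refine Integrable.mono' ((integrableOn_Ioi_inv_pow (k + 1) hx).const_mul C)
    (((continuousOn_recessiveP hf hb hC).mono (Ioi_subset_Ioi hx.le)).aestronglyMeasurable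
      measurableSet_Ioi) ?_
  filter_upwards [ae_restrict_mem measurableSet_Ioi] with y hy
  rw [mul_one_div]
  exact abs_recessiveP_le hb hC (hx.trans hy)

theorem abs_integral_recessiveP_le
    (hb : ∀ y, 0 < y → |f y| ≤ C / y ^ k) (hC : 0 ≤ C) {x : ℝ} (hx : 0 < x) :
    |∫ z in Ioi x, recessiveP f z| ≤ C / ((k + 2) * x ^ (k + 2)) := by
  have h : C / ((k + 2) * x ^ (k + 2)) = ∫ z in Ioi x, C * (1 / z ^ (k + 1 + 2)) := by
    rw [integral_const_mul, integral_Ioi_inv_pow (k + 1) hx]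
    push_cast
    ring
  rw [h, ← Real.norm_eq_abs]
  refine norm_integral_le_of_norm_le ((integrableOn_Ioi_inv_pow (k + 1) hx).const_mul C) ?_
  filter_upwards [ae_restrict_mem measurableSet_Ioi] with y hy
  rw [mul_one_div]
  exact abs_recessiveP_le hb hC (hx.trans hy)

/-- The gain of `1 / ((k + 2) * x)` over the bound on `f` yields factorials under iteration. -/
theorem abs_recessiveT_le
    (hb : ∀ y, 0 < y → |f y| ≤ C / y ^ k) (hC : 0 ≤ C) {x : ℝ} (hx : 0 < x) :
    |recessiveT f x| ≤ C / ((k + 2) * x ^ (k + 1)) := by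
  rw [recessiveT, abs_mul, abs_of_pos hx]
  calc _ ≤ x * (C / ((k + 2) * x ^ (k + 2))) := by
        gcongr; exact abs_integral_recessiveP_le hb hC hx
    _ = _ := by field_simp; ring

theorem abs_recessiveTDeriv_le
    (hb : ∀ y, 0 < y → |f y| ≤ C / y ^ k) (hC : 0 ≤ C) {x : ℝ} (hx : 0 < x) :
    |recessiveTDeriv f x| ≤ 2 * C / x ^ (k + 2) := by
  rw [recessiveTDeriv]
  refine (abs_sub _ _).trans ?_
  have h1 : C / ((k + 2) * x ^ (k + 2)) ≤ C / x ^ (k + 2) := by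
    gcongr
    refine le_mul_of_one_le_left (by positivity) ?_
    have : (0 : ℝ) ≤ k := k.cast_nonneg
    linarith
  have h2 : |x * recessiveP f x| ≤ C / x ^ (k + 2) := by
    rw [abs_mul, abs_of_pos hx]
    calc _ ≤ x * (C / x ^ (k + 3)) := by gcongr; exact abs_recessiveP_le hb hC hx
      _ = _ := by field_simp; ring
  have := abs_integral_recessiveP_le hb hC hx
  rw [two_mul, add_div]
  linarith

theorem hasDerivAt_recessiveT (hf : ContinuousOn f (Ioi 0))
    (hb : ∀ y, 0 < y → |f y| ≤ C / y ^ k) (hC : 0 ≤ C) {x : ℝ} (hx : 0 < x) :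
    HasDerivAt (recessiveT f) (recessiveTDeriv f x) x := by
  have h := (hasDerivAt_id x).mul (hasDerivAt_integral_Ioi_lower (continuousOn_recessiveP hf hb hC)
    (fun _ => integrableOn_recessiveP hf hb hC) hx)
  refine h.congr_deriv ?_
  simp only [recessiveTDeriv, id]
  ring

theorem hasDerivAt_recessiveTDeriv (hf : ContinuousOn f (Ioi 0))
    (hb : ∀ y, 0 < y → |f y| ≤ C / y ^ k) (hC : 0 ≤ C) {x : ℝ} (hx : 0 < x) :
    HasDerivAt (recessiveTDeriv f)
      (recessiveTDeriv f x - recessiveT f x / x + f x / x ^ 2) x := by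
  have h := (hasDerivAt_integral_Ioi_lower (continuousOn_recessiveP hf hb hC)
    (fun _ => integrableOn_recessiveP hf hb hC) hx).sub
    ((hasDerivAt_id x).mul (hasDerivAt_recessiveP hf hb hC hx))
  refine h.congr_deriv ?_
  simp only [recessiveTDeriv, recessiveT, id]
  field_simp
  ring

end Recessive

/-! ### The explicit coefficients of `λ ^ 2` and `λ ^ 3` -/

/-- The coefficient of `λ ^ 2` in `exp (x / 2) * W_{1,b}(x)`, where `λ = b ^ 2 - 1 / 4`. -/
noncomputable def coeffTwo (x : ℝ) : ℝ := expMulE1 x + x * laplaceLogDiv x - 1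

/-- The derivative of `coeffTwo`. -/
noncomputable def coeffTwoDeriv (x : ℝ) : ℝ := laplaceLogDiv x - 1 / x

/-- The coefficient of `λ ^ 3` in `exp (x / 2) * W_{1,b}(x)`, where `λ = b ^ 2 - 1 / 4`. -/
noncomputable def coeffThree (x : ℝ) : ℝ := laplaceLogDiv x - 2 * coeffTwo x

/-- The derivative of `coeffThree`. -/
noncomputable def coeffThreeDeriv (x : ℝ) : ℝ := -(expMulE1 x / x) - 2 * coeffTwoDeriv x

theorem hasDerivAt_coeffTwo {x : ℝ} (hx : 0 < x) : HasDerivAt coeffTwo (coeffTwoDeriv x) x := by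
  have h := ((hasDerivAt_expMulE1 hx).add
    ((hasDerivAt_id x).mul (hasDerivAt_laplaceLogDiv hx))).sub_const 1
  refine h.congr_deriv ?_
  simp only [coeffTwoDeriv, id]
  field_simp
  ring

theorem hasDerivAt_coeffTwoDeriv {x : ℝ} (hx : 0 < x) :
    HasDerivAt coeffTwoDeriv (coeffTwoDeriv x - coeffTwo x / x + 1 / x ^ 2) x := by
  have h := (hasDerivAt_laplaceLogDiv hx).sub ((hasDerivAt_id x).fun_inv hx.ne')
  have h' : coeffTwoDeriv = laplaceLogDiv - fun x => (id x)⁻¹ := by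
    ext; simp [coeffTwoDeriv]
  rw [h']
  refine h.congr_deriv ?_
  simp only [coeffTwo, Pi.sub_apply, id]
  field_simp
  ring

theorem hasDerivAt_coeffThree {x : ℝ} (hx : 0 < x) :
    HasDerivAt coeffThree (coeffThreeDeriv x) x :=
  (hasDerivAt_laplaceLogDiv hx).sub ((hasDerivAt_coeffTwo hx).const_mul 2)

theorem hasDerivAt_coeffThreeDeriv {x : ℝ} (hx : 0 < x) :
    HasDerivAt coeffThreeDeriv (coeffThreeDeriv x - coeffThree x / x + coeffTwo x / x ^ 2) x := by
  have h := ((hasDerivAt_expMulE1 hx).fun_div (hasDerivAt_id x) hx.ne').neg.sub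
    ((hasDerivAt_coeffTwoDeriv hx).const_mul 2)
  refine h.congr_deriv ?_
  simp only [coeffThreeDeriv, coeffThree, coeffTwoDeriv, coeffTwo, id]
  field_simp
  ring

theorem abs_coeffTwo_le {x : ℝ} (hx : 0 < x) : |coeffTwo x| ≤ 2 / x := by
  have h1 := expMulE1_nonneg hx
  have h2 := expMulE1_le hx
  have h3 := mul_le_mul_of_nonneg_left (laplaceLogDiv_le hx) hx.le
  have h4 := mul_le_mul_of_nonneg_left (sub_le_laplaceLogDiv hx) hx.le
  have e3 : x * (1 / x) = 1 := by field_simp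
  have e4 : x * (1 / x - 1 / x ^ 2) = 1 - 1 / x := by field_simp
  have e5 : 2 / x = 1 / x + 1 / x := by ring
  have : 0 < 1 / x := by positivity
  rw [coeffTwo, abs_le]
  constructor <;> linarith

theorem abs_coeffThree_le {x : ℝ} (hx : 0 < x) : |coeffThree x| ≤ 5 / x := by
  have h1 := abs_le.1 (abs_coeffTwo_le hx)
  have h2 := laplaceLogDiv_le hx
  have h3 := laplaceLogDiv_nonneg x
  have e2 : 2 / x = 2 * (1 / x) := by ring
  have e5 : 5 / x = 5 * (1 / x) := by ring
  have : 0 < 1 / x := by positivity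
  rw [coeffThree, abs_le]
  constructor <;> linarith

theorem abs_coeffThreeDeriv_le {x : ℝ} (hx : 0 < x) : |coeffThreeDeriv x| ≤ 10 / x ^ 2 := by
  have h1 := laplaceLogDiv_le hx
  have h2 := sub_le_laplaceLogDiv hx
  have h3 : expMulE1 x / x ≤ 1 / x ^ 2 := by
    have := div_le_div_of_nonneg_right (expMulE1_le hx) hx.le
    rwa [div_div, ← sq] at this
  have h4 : 0 ≤ expMulE1 x / x := div_nonneg (expMulE1_nonneg hx) hx.le
  have e5 : 10 / x ^ 2 = 10 * (1 / x ^ 2) := by ring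
  have : 0 < 1 / x ^ 2 := by positivity
  rw [coeffThreeDeriv, coeffTwoDeriv, abs_le]
  constructor <;> linarith

/-! ### Higher coefficients and termwise differentiation of their series -/

/-- `higherCoeff j` is the coefficient of `λ ^ (j + 3)` in `exp (x / 2) * W_{1,b}(x)`, where
`λ = b ^ 2 - 1 / 4`. -/
noncomputable def higherCoeff : ℕ → ℝ → ℝ
  | 0 => coeffThree
  | j + 1 => recessiveT (higherCoeff j)

/-- The derivative of `higherCoeff j`. -/
noncomputable def higherCoeffDeriv : ℕ → ℝ → ℝ
  | 0 => coeffThreeDeriv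
  | j + 1 => recessiveTDeriv (higherCoeff j)

/-- The coefficient preceding `higherCoeff j`. -/
noncomputable def higherCoeffPrev : ℕ → ℝ → ℝ
  | 0 => coeffTwo
  | j + 1 => higherCoeff j

theorem higherCoeff_spec (j : ℕ) : ContinuousOn (higherCoeff j) (Ioi 0) ∧
    ∀ x, 0 < x → |higherCoeff j x| ≤ 5 / j.factorial / x ^ (j + 1) := by
  induction j with
  | zero =>
    refine ⟨fun x hx => (hasDerivAt_coeffThree hx).continuousAt.continuousWithinAt, fun x hx => ?_⟩
    simpa using! abs_coeffThree_le hx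
  | succ j ih =>
    have hC : (0 : ℝ) ≤ 5 / j.factorial := by positivity
    refine ⟨fun x hx => (hasDerivAt_recessiveT ih.1 ih.2 hC hx).continuousAt.continuousWithinAt,
      fun x hx => (abs_recessiveT_le ih.2 hC hx).trans ?_⟩
    rw [Nat.factorial_succ, div_div, div_div, ← mul_assoc]
    push_cast
    have : (0 : ℝ) < j.factorial := by positivity
    -- The decay exponent at stage `j` is `k = j + 1`, so the gain is `1 / (j + 3)`, better than the
    -- `1 / (j + 1)` needed.
    have : (j + 1 : ℝ) * j.factorial ≤ j.factorial * (j + 1 + 2) := by nlinarith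
    gcongr

/-- Derivatives and preceding coefficients at index `j + 1` come with `1 / j!` only. Weakening to `2
^ j / j!` gives all majorants one shape. -/
theorem factorial_inv_le (j : ℕ) : (1 : ℝ) / j.factorial ≤ 2 ^ (j + 1) / (j + 1).factorial := by
  rw [div_le_div_iff₀ (by positivity) (by positivity), Nat.factorial_succ]
  have : ((j + 1 : ℕ) : ℝ) ≤ 2 ^ (j + 1) := by exact_mod_cast (Nat.lt_two_pow_self).le
  push_cast at this ⊢
  have h : (0 : ℝ) < j.factorial := by positivity
  nlinarith

theorem abs_higherCoeffDeriv_le (j : ℕ) {x : ℝ} (hx : 0 < x) :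
    |higherCoeffDeriv j x| ≤ 10 * (2 ^ j / j.factorial) / x ^ (j + 2) := by
  cases j with
  | zero => simpa using! abs_coeffThreeDeriv_le hx
  | succ j =>
    refine (abs_recessiveTDeriv_le (higherCoeff_spec j).2 (by positivity) hx).trans ?_
    have := factorial_inv_le j
    rw [show (2 : ℝ) * (5 / j.factorial) = 10 * (1 / j.factorial) by ring]
    gcongr

theorem abs_higherCoeffPrev_le (j : ℕ) {x : ℝ} (hx : 0 < x) :
    |higherCoeffPrev j x| ≤ (5 + 2 / x) * (2 ^ j / j.factorial) / x ^ j := by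
  cases j with
  | zero =>
    simp only [pow_zero, Nat.factorial_zero, Nat.cast_one, div_one, mul_one]
    have := abs_coeffTwo_le hx
    simp only [higherCoeffPrev]
    linarith
  | succ j =>
    refine ((higherCoeff_spec j).2 x hx).trans ?_
    have := factorial_inv_le j
    gcongr
    calc (5 : ℝ) / j.factorial = 5 * (1 / j.factorial) := by ring
      _ ≤ _ := by gcongr; have : 0 < 2 / x := by positivity
                  linarith

theorem hasDerivAt_higherCoeff (j : ℕ) {x : ℝ} (hx : 0 < x) :
    HasDerivAt (higherCoeff j) (higherCoeffDeriv j x) x := by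
  cases j with
  | zero => exact hasDerivAt_coeffThree hx
  | succ j =>
    obtain ⟨h1, h2⟩ := higherCoeff_spec j
    exact hasDerivAt_recessiveT h1 h2 (by positivity) hx

theorem hasDerivAt_higherCoeffDeriv (j : ℕ) {x : ℝ} (hx : 0 < x) :
    HasDerivAt (higherCoeffDeriv j)
      (higherCoeffDeriv j x - higherCoeff j x / x + higherCoeffPrev j x / x ^ 2) x := by
  cases j with
  | zero => exact hasDerivAt_coeffThreeDeriv hx
  | succ j =>
    obtain ⟨h1, h2⟩ := higherCoeff_spec j
    exact hasDerivAt_recessiveTDeriv h1 h2 (by positivity) hx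

theorem summable_majorant (r M d : ℝ) (hd : 0 < d) (i : ℕ) :
    Summable fun j : ℕ => r ^ j * (M * (2 ^ j / j.factorial) / d ^ (j + i)) := by
  refine ((Real.summable_pow_div_factorial (2 * r / d)).mul_left (M / d ^ i)).congr fun j => ?_
  rw [div_pow, mul_pow, pow_add]
  field_simp

theorem abs_higherCoeff_le (j : ℕ) {x : ℝ} (hx : 0 < x) :
    |higherCoeff j x| ≤ 5 * (2 ^ j / j.factorial) / x ^ (j + 1) := by
  refine ((higherCoeff_spec j).2 x hx).trans ?_
  rw [← mul_div_assoc]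
  gcongr
  exact le_mul_of_one_le_right (by norm_num) (one_le_pow₀ (by norm_num))

theorem norm_term_le {l : ℂ} {j i : ℕ} {y M x d : ℝ} (hd : 0 < d) (hdx : d ≤ x) (hM : 0 ≤ M)
    (h : |y| ≤ M * (2 ^ j / j.factorial) / x ^ (j + i)) :
    ‖l ^ j * (y : ℂ)‖ ≤ ‖l‖ ^ j * (M * (2 ^ j / j.factorial) / d ^ (j + i)) := by
  rw [norm_mul, norm_pow, Complex.norm_real, Real.norm_eq_abs]
  gcongr
  refine h.trans ?_
  gcongr

/-- The series `∑ λ ^ j * higherCoeff j x`. -/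
noncomputable def higherSum (l : ℂ) (x : ℝ) : ℂ := ∑' j : ℕ, l ^ j * (higherCoeff j x : ℂ)

/-- The derivative of `higherSum l`. -/
noncomputable def higherSumDeriv (l : ℂ) (x : ℝ) : ℂ :=
  ∑' j : ℕ, l ^ j * (higherCoeffDeriv j x : ℂ)

theorem summable_higherSum (l : ℂ) {x : ℝ} (hx : 0 < x) :
    Summable fun j : ℕ => l ^ j * (higherCoeff j x : ℂ) :=
  .of_norm_bounded (summable_majorant ‖l‖ 5 x hx 1) fun j =>
    norm_term_le hx le_rfl (by norm_num) (abs_higherCoeff_le j hx)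

theorem summable_higherSumDeriv (l : ℂ) {x : ℝ} (hx : 0 < x) :
    Summable fun j : ℕ => l ^ j * (higherCoeffDeriv j x : ℂ) :=
  .of_norm_bounded (summable_majorant ‖l‖ 10 x hx 2) fun j =>
    norm_term_le hx le_rfl (by norm_num) (abs_higherCoeffDeriv_le j hx)

theorem hasDerivAt_higherSum (l : ℂ) {x : ℝ} (hx : 0 < x) :
    HasDerivAt (higherSum l) (higherSumDeriv l x) x := by
  have h2 : 0 < x / 2 := by positivity
  have hm : x ∈ Ioi (x / 2) := mem_Ioi.2 (by linarith)
  refine hasDerivAt_tsum_of_isPreconnected (g := fun j z => l ^ j * (higherCoeff j z : ℂ))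
    (g' := fun j z => l ^ j * (higherCoeffDeriv j z : ℂ))
    (summable_majorant ‖l‖ 10 (x / 2) h2 2) isOpen_Ioi
    isPreconnected_Ioi (fun j y hy => ?_) (fun j y hy => ?_) hm (summable_higherSum l hx) hm
  · exact (hasDerivAt_higherCoeff j (h2.trans hy)).ofReal_comp.const_mul _
  · exact norm_term_le h2 (le_of_lt hy) (by norm_num) (abs_higherCoeffDeriv_le j (h2.trans hy))

/-- Termwise differentiation on `(x / 2, ∞)`, where the majorants are uniform. Summing the recursion
shifts the index by one, hence the term `coeffTwo + l * higherSum`. -/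
theorem hasDerivAt_higherSumDeriv (l : ℂ) {x : ℝ} (hx : 0 < x) :
    HasDerivAt (higherSumDeriv l) (higherSumDeriv l x - higherSum l x / x +
      ((coeffTwo x : ℂ) + l * higherSum l x) / (x : ℂ) ^ 2) x := by
  have h2 : 0 < x / 2 := by positivity
  have hm : x ∈ Ioi (x / 2) := mem_Ioi.2 (by linarith)
  have hs := ((summable_majorant ‖l‖ 10 (x / 2) h2 2).add
    ((summable_majorant ‖l‖ 5 (x / 2) h2 1).mul_right (1 / (x / 2)))).add
    ((summable_majorant ‖l‖ (5 + 2 / (x / 2)) (x / 2) h2 0).mul_right (1 / (x / 2) ^ 2))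
  have key : HasDerivAt (higherSumDeriv l) (∑' j : ℕ, l ^ j * ((higherCoeffDeriv j x -
      higherCoeff j x / x + higherCoeffPrev j x / x ^ 2 : ℝ) : ℂ)) x := by
    refine hasDerivAt_tsum_of_isPreconnected (g := fun j z => l ^ j * (higherCoeffDeriv j z : ℂ))
      (g' := fun j z => l ^ j * ((higherCoeffDeriv j z -
      higherCoeff j z / z + higherCoeffPrev j z / z ^ 2 : ℝ) : ℂ)) hs isOpen_Ioi
      isPreconnected_Ioi (fun j y hy => ?_) (fun j y hy => ?_) hm (summable_higherSumDeriv l hx) hm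
    · exact (hasDerivAt_higherCoeffDeriv j (h2.trans hy)).ofReal_comp.const_mul _
    · have hy0 : 0 < y := h2.trans hy
      have hle : x / 2 ≤ y := le_of_lt hy
      have b1 := norm_term_le (l := l) h2 hle (by norm_num) (abs_higherCoeffDeriv_le j hy0)
      have b2 := norm_term_le (l := l) h2 hle (by norm_num) (abs_higherCoeff_le j hy0)
      have b3 : ‖l ^ j * (higherCoeffPrev j y : ℂ)‖ ≤
          ‖l‖ ^ j * ((5 + 2 / (x / 2)) * (2 ^ j / j.factorial) / (x / 2) ^ (j + 0)) := by
        refine norm_term_le (l := l) h2 hle (by positivity) ((abs_higherCoeffPrev_le j hy0).trans ?_)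
        rw [add_zero]
        gcongr
      have e : l ^ j * ((higherCoeffDeriv j y -
          higherCoeff j y / y + higherCoeffPrev j y / y ^ 2 : ℝ) : ℂ) =
          l ^ j * (higherCoeffDeriv j y : ℂ) - l ^ j * (higherCoeff j y : ℂ) * ((1 / y : ℝ) : ℂ) +
          l ^ j * (higherCoeffPrev j y : ℂ) * ((1 / y ^ 2 : ℝ) : ℂ) := by
        push_cast; ring
      rw [e]
      refine (norm_add_le _ _).trans (add_le_add ((norm_sub_le _ _).trans (add_le_add b1 ?_)) ?_)
      · rw [norm_mul, Complex.norm_real, Real.norm_eq_abs, abs_of_pos (show 0 < 1 / y by positivity)]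
        gcongr
      · rw [norm_mul, Complex.norm_real, Real.norm_eq_abs,
          abs_of_pos (show 0 < 1 / y ^ 2 by positivity)]
        gcongr
  refine key.congr_deriv ?_
  have s1 := (summable_higherSumDeriv l hx).hasSum
  have s2 := (summable_higherSum l hx).hasSum
  have s3 : HasSum (fun j : ℕ => l ^ j * (higherCoeffPrev j x : ℂ))
      ((coeffTwo x : ℂ) + l * higherSum l x) := by
    have h := (s2.mul_left l)
    have h' : (fun j : ℕ => l * (l ^ j * (higherCoeff j x : ℂ))) =
        fun j : ℕ => l ^ (j + 1) * (higherCoeffPrev (j + 1) x : ℂ) := by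
      ext j
      rw [pow_succ', mul_assoc]
      rfl
    rw [h'] at h
    have h4 := (hasSum_nat_add_iff (f := fun j : ℕ => l ^ j * (higherCoeffPrev j x : ℂ)) 1).1 h
    simpa [higherCoeffPrev, add_comm, higherSum] using h4
  have := (s1.sub (s2.div_const (x : ℂ))).add (s3.div_const ((x : ℂ) ^ 2))
  refine HasSum.tsum_eq ?_
  refine this.congr_fun fun j => ?_
  push_cast
  ring

theorem norm_higherSum_le (l : ℂ) {x : ℝ} (hx : 1 ≤ x) :
    ‖higherSum l x‖ ≤ ∑' j : ℕ, ‖l‖ ^ j * (5 * (2 ^ j / j.factorial) / 1 ^ (j + 1)) :=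
  tsum_of_norm_bounded (summable_majorant ‖l‖ 5 1 one_pos 1).hasSum fun j =>
    norm_term_le one_pos hx (by norm_num) (abs_higherCoeff_le j (one_pos.trans_le hx))

/-! ### The series as a normalized solution of Whittaker's equation -/

/-- The function `exp (x / 2) * W_{1,b}(x)` in terms of `l = b ^ 2 - 1 / 4`. -/
noncomputable def whittakerSeries (l : ℂ) (x : ℝ) : ℂ :=
  x + l + l ^ 2 * coeffTwo x + l ^ 3 * higherSum l x

/-- The derivative of `whittakerSeries l`. -/
noncomputable def whittakerSeriesDeriv (l : ℂ) (x : ℝ) : ℂ :=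
  1 + l ^ 2 * coeffTwoDeriv x + l ^ 3 * higherSumDeriv l x

theorem hasDerivAt_whittakerSeries (l : ℂ) {x : ℝ} (hx : 0 < x) :
    HasDerivAt (whittakerSeries l) (whittakerSeriesDeriv l x) x := by
  have h1 : HasDerivAt (fun x : ℝ => (x : ℂ)) 1 x := Complex.ofRealCLM.hasDerivAt
  exact ((h1.add_const l).add ((hasDerivAt_coeffTwo hx).ofReal_comp.const_mul (l ^ 2))).add
    ((hasDerivAt_higherSum l hx).const_mul (l ^ 3))

theorem hasDerivAt_whittakerSeriesDeriv (l : ℂ) {x : ℝ} (hx : 0 < x) :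
    HasDerivAt (whittakerSeriesDeriv l) (whittakerSeriesDeriv l x - whittakerSeries l x / x +
      l * whittakerSeries l x / (x : ℂ) ^ 2) x := by
  have h := (((hasDerivAt_coeffTwoDeriv hx).ofReal_comp.const_mul (l ^ 2)).const_add 1).add
    ((hasDerivAt_higherSumDeriv l hx).const_mul (l ^ 3))
  refine h.congr_deriv ?_
  have : (x : ℂ) ≠ 0 := by exact_mod_cast hx.ne'
  simp only [whittakerSeriesDeriv, whittakerSeries]
  push_cast
  field_simp
  ring

theorem tendsto_whittakerSeries_div (l : ℂ) :
    Tendsto (fun x : ℝ => whittakerSeries l x / x) atTop (𝓝 1) := by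
  set M : ℝ := ‖l‖ + ‖l‖ ^ 2 * 2 +
    ‖l‖ ^ 3 * ∑' j : ℕ, ‖l‖ ^ j * (5 * (2 ^ j / j.factorial) / 1 ^ (j + 1)) with hM
  rw [tendsto_iff_norm_sub_tendsto_zero]
  refine squeeze_zero' (.of_forall fun _ => norm_nonneg _) ?_
    ((tendsto_const_nhds (x := M)).div_atTop tendsto_id)
  filter_upwards [eventually_ge_atTop 1] with x hx
  have hx0 : 0 < x := one_pos.trans_le hx
  have hxc : (x : ℂ) ≠ 0 := by exact_mod_cast hx0.ne'
  have e : whittakerSeries l x / x - 1 = (l + l ^ 2 * coeffTwo x + l ^ 3 * higherSum l x) / x := by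
    rw [whittakerSeries]; field_simp; ring
  rw [e, norm_div, Complex.norm_real, Real.norm_eq_abs, abs_of_pos hx0]
  simp only [id]
  gcongr
  refine (norm_add₃_le).trans ?_
  rw [norm_mul, norm_mul, norm_pow, norm_pow, Complex.norm_real, Real.norm_eq_abs]
  have h1 : |coeffTwo x| ≤ 2 := (abs_coeffTwo_le hx0).trans (div_le_self two_pos.le hx)
  have h2 := norm_higherSum_le l hx
  rw [hM]
  gcongr

theorem isWhittakerW_one (b : ℂ) :
    IsWhittakerW 1 b fun x => Complex.exp (-(x : ℂ) / 2) * whittakerSeries (b ^ 2 - 1 / 4) x := by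
  set l := b ^ 2 - 1 / 4 with hl
  have hb : 1 / 4 - b ^ 2 = -l := by rw [hl]; ring
  have he : ∀ x : ℝ, HasDerivAt (fun x : ℝ => Complex.exp (-(x : ℂ) / 2))
      (Complex.exp (-(x : ℂ) / 2) * (-1 / 2)) x := fun x => by
    have h1 : HasDerivAt (fun x : ℝ => (x : ℂ)) 1 x := Complex.ofRealCLM.hasDerivAt
    exact (h1.neg.div_const 2).cexp
  refine ⟨⟨fun x => Complex.exp (-(x : ℂ) / 2) *
    (whittakerSeriesDeriv l x - whittakerSeries l x / 2), fun x hx => ⟨?_, ?_⟩⟩, ?_⟩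
  · refine ((he x).mul (hasDerivAt_whittakerSeries l hx)).congr_deriv ?_
    ring
  · refine ((he x).mul ((hasDerivAt_whittakerSeriesDeriv l hx).sub
      ((hasDerivAt_whittakerSeries l hx).div_const 2))).congr_deriv ?_
    rw [hb]
    simp only [Pi.sub_apply]
    ring
  · rw [Asymptotics.isEquivalent_iff_tendsto_one]
    · refine (tendsto_whittakerSeries_div l).congr' ?_
      filter_upwards [eventually_gt_atTop 0] with x hx
      have hxc : (x : ℂ) ≠ 0 := by exact_mod_cast hx.ne'
      simp only [Pi.div_apply, Complex.cpow_one]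
      field_simp [Complex.exp_ne_zero]
    · filter_upwards [eventually_gt_atTop 0] with x hx
      have hxc : (x : ℂ) ≠ 0 := by exact_mod_cast hx.ne'
      simp [hxc]

/-! ### Uniqueness of the normalized solution -/

/-- The first-order system for `(f, f')` is uniformly Lipschitz on a bounded interval containing `x`
and `x₀` and staying away from 0. -/
theorem linear_ode_unique {q : ℝ → ℂ} (hq : ContinuousOn q (Ioi 0)) {f f' g g' : ℝ → ℂ}
    (hf : ∀ x, 0 < x → HasDerivAt f (f' x) x ∧ HasDerivAt f' (q x * f x) x)
    (hg : ∀ x, 0 < x → HasDerivAt g (g' x) x ∧ HasDerivAt g' (q x * g x) x)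
    {x₀ : ℝ} (hx₀ : 0 < x₀) (h0 : f x₀ = g x₀) (h1 : f' x₀ = g' x₀) {x : ℝ} (hx : 0 < x) :
    f x = g x := by
  have hm : 0 < min x x₀ := lt_min hx hx₀
  set a := min x x₀ / 2 with ha
  set b := max x x₀ + 1 with hb
  have ha0 : 0 < a := by positivity
  have hax : a < x ∧ a < x₀ := by
    constructor
    · linarith [min_le_left x x₀]
    · linarith [min_le_right x x₀]
  have hbx : x < b ∧ x₀ < b := by
    constructor
    · linarith [le_max_left x x₀]
    · linarith [le_max_right x x₀]
  obtain ⟨M, hM⟩ := isCompact_Icc.exists_bound_of_continuousOn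
    (hq.mono fun y (hy : y ∈ Icc a b) => ha0.trans_le hy.1)
  have key := ODE_solution_unique_of_mem_Ioo (v := fun t (p : ℂ × ℂ) => (p.2, q t * p.1))
    (s := fun _ => univ) (K := (1 + |M|).toNNReal) (f := fun t => (f t, f' t))
    (g := fun t => (g t, g' t)) (a := a) (b := b) (t₀ := x₀) ?_ ⟨hax.2, hbx.2⟩ ?_ ?_ ?_
  · exact congrArg Prod.fst (key ⟨hax.1, hbx.1⟩)
  · intro t ht
    refine LipschitzOnWith.of_dist_le_mul fun p _ p' _ => ?_
    rw [Real.coe_toNNReal _ (by positivity), dist_eq_norm, dist_eq_norm]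
    have hp1 : ‖p.1 - p'.1‖ ≤ ‖p - p'‖ := norm_fst_le (p - p')
    have hp2 : ‖p.2 - p'.2‖ ≤ ‖p - p'‖ := norm_snd_le (p - p')
    have hqt : ‖q t‖ ≤ |M| := (hM t ⟨ht.1.le, ht.2.le⟩).trans (le_abs_self M)
    simp only [Prod.mk_sub_mk]
    refine max_le ?_ ?_
    · refine hp2.trans (le_mul_of_one_le_left (norm_nonneg _) ?_)
      linarith [abs_nonneg M]
    · rw [← mul_sub, norm_mul]
      gcongr
      linarith
  · intro t ht
    have := hf t (ha0.trans ht.1)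
    exact ⟨this.1.prodMk this.2, mem_univ _⟩
  · intro t ht
    have := hg t (ha0.trans ht.1)
    exact ⟨this.1.prodMk this.2, mem_univ _⟩
  · simp [h0, h1]

/-- If the constant Wronskian `c` were nonzero, `(w₂ / w₁)' = c / w₁ ^ 2` would be of order `exp x /
x ^ 2`, contradicting `w₂ / w₁ → 1`. So `w₂` is a multiple of `w₁`, and the limit makes the factor
1. -/
theorem IsWhittakerW.unique {b : ℂ} {w₁ w₂ : ℝ → ℂ} (h₁ : IsWhittakerW 1 b w₁)
    (h₂ : IsWhittakerW 1 b w₂) {x : ℝ} (hx : 0 < x) : w₁ x = w₂ x := by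
  obtain ⟨⟨d₁, hd₁⟩, ha₁⟩ := h₁
  obtain ⟨⟨d₂, hd₂⟩, ha₂⟩ := h₂
  set q : ℝ → ℂ := fun x => -(-1 / 4 + 1 / (x : ℂ) + (1 / 4 - b ^ 2) / (x : ℂ) ^ 2) with hq
  set m : ℝ → ℂ := fun x => (x : ℂ) ^ (1 : ℂ) * Complex.exp (-(x : ℂ) / 2) with hm
  have hm0 : ∀ x : ℝ, 0 < x → m x ≠ 0 := fun x hx => by
    have hxc : (x : ℂ) ≠ 0 := by exact_mod_cast hx.ne'
    simp [hm, hxc]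
  have hmev : ∀ᶠ x in atTop, m x ≠ 0 := (eventually_gt_atTop 0).mono hm0
  have hqc : ContinuousOn q (Ioi 0) := by
    have hne : ∀ x ∈ Ioi (0 : ℝ), (x : ℂ) ≠ 0 := fun x hx => by exact_mod_cast (ne_of_gt hx)
    refine ContinuousOn.neg ((continuousOn_const.add (continuousOn_const.div ?_ hne)).add
      (continuousOn_const.div ?_ fun x hx => pow_ne_zero 2 (hne x hx)))
    · exact Complex.continuous_ofReal.continuousOn
    · exact (Complex.continuous_ofReal.pow 2).continuousOn
  have hw1 : Tendsto (fun x => w₁ x / m x) atTop (𝓝 1) :=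
    (Asymptotics.isEquivalent_iff_tendsto_one hmev).1 ha₁
  have hw2 : Tendsto (fun x => w₂ x / m x) atTop (𝓝 1) :=
    (Asymptotics.isEquivalent_iff_tendsto_one hmev).1 ha₂
  have hr : Tendsto (fun x => w₂ x / w₁ x) atTop (𝓝 1) := by
    have := hw2.div hw1 one_ne_zero
    rw [div_one] at this
    refine this.congr' ?_
    filter_upwards [hmev] with x hx
    simp only [Pi.div_apply]
    exact div_div_div_cancel_right₀ hx _ _
  have hh : Tendsto (fun x => (m x / w₁ x) ^ 2) atTop (𝓝 1) := by
    have := (hw1.inv₀ one_ne_zero).pow 2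
    simpa using this
  have hre : ∀ᶠ x in atTop, 1 / 2 < ((m x / w₁ x) ^ 2).re :=
    ((Complex.continuous_re.tendsto 1).comp hh).eventually (lt_mem_nhds (by norm_num))
  obtain ⟨X, hX⟩ := (hre.and (eventually_gt_atTop 0)).exists_forall_of_atTop
  have hX0 : 0 < X := (hX X le_rfl).2
  -- At a zero of `w₁`, division by zero gives `m x / w₁ x = 0`, against the real part exceeding `1
  -- / 2`.
  have hw0 : ∀ x, X ≤ x → w₁ x ≠ 0 := fun x hx h => by
    have := (hX x hx).1
    rw [h] at this
    norm_num at this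
  -- the Wronskian is constant
  obtain ⟨c, hc⟩ : ∃ c, ∀ x, 0 < x → w₁ x * d₂ x - d₁ x * w₂ x = c := by
    have hd : ∀ x ∈ Ioi (0 : ℝ), HasDerivAt (fun x => w₁ x * d₂ x - d₁ x * w₂ x) 0 x := by
      intro x hx
      have h := ((hd₁ x hx).1.fun_mul (hd₂ x hx).2).fun_sub ((hd₁ x hx).2.fun_mul (hd₂ x hx).1)
      exact h.congr_deriv (by ring)
    refine ⟨w₁ 1 * d₂ 1 - d₁ 1 * w₂ 1, fun x hx => ?_⟩
    exact isOpen_Ioi.is_const_of_deriv_eq_zero isPreconnected_Ioi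
      (fun y hy => (hd y hy).differentiableAt.differentiableWithinAt)
      (fun y hy => (hd y hy).deriv) hx (mem_Ioi.2 one_pos)
  have hc0 : c = 0 := by
    by_contra hne
    -- The real part of `1 / w₁ ^ 2` is at least `1 / 2 * 1 / 2` beyond `X`, so subtracting `x / 4`
    -- leaves a monotone function and forces linear growth.
    set φ : ℝ → ℝ := fun x => (w₂ x / w₁ x / c).re - x / 4 with hφ
    have hder : ∀ x, X ≤ x → HasDerivAt φ ((1 / w₁ x ^ 2).re - 1 / 4) x := by
      intro x hx
      have hx0 := hX0.trans_le hx
      have h1 := (((hd₂ x hx0).1.fun_div (hd₁ x hx0).1 (hw0 x hx)).div_const c)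
      have h2 := (Complex.reCLM.hasFDerivAt.comp_hasDerivAt x h1).sub
        ((hasDerivAt_id x).div_const 4)
      refine h2.congr_deriv ?_
      have e : d₂ x * w₁ x - w₂ x * d₁ x = c := by rw [← hc x hx0]; ring
      rw [e, div_right_comm, div_self hne]
      rfl
    have hmono : MonotoneOn φ (Ici X) := by
      refine monotoneOn_of_deriv_nonneg (convex_Ici X)
        (fun x hx => (hder x hx).continuousAt.continuousWithinAt) ?_ ?_
      · intro x hx
        rw [interior_Ici] at hx
        exact (hder x (le_of_lt hx)).differentiableAt.differentiableWithinAt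
      · intro x hx
        rw [interior_Ici] at hx
        have hxX : X ≤ x := le_of_lt hx
        rw [(hder x hxX).deriv]
        have hx0 := hX0.trans_le hxX
        have hxc : (x : ℂ) ≠ 0 := by exact_mod_cast hx0.ne'
        have e : 1 / w₁ x ^ 2 = ((Real.exp x / x ^ 2 : ℝ) : ℂ) * (m x / w₁ x) ^ 2 := by
          have hw := hw0 x hxX
          have he : Complex.exp (x : ℂ) * Complex.exp (-(x : ℂ) / 2) ^ 2 = 1 := by
            rw [sq, ← Complex.exp_add, ← Complex.exp_add]
            simp
          rw [neg_div] at he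
          simp only [hm, Complex.cpow_one]
          push_cast
          field_simp
          linear_combination -he
        rw [e, Complex.re_ofReal_mul]
        have h1 : 1 / 2 ≤ Real.exp x / x ^ 2 := by
          rw [le_div_iff₀ (by positivity)]
          have := Real.quadratic_le_exp_of_nonneg hx0.le
          linarith
        nlinarith [(hX x hxX).1]
    have hlim : Tendsto (fun x => (w₂ x / w₁ x / c).re) atTop (𝓝 ((1 / c : ℂ).re)) :=
      (Complex.continuous_re.tendsto _).comp (hr.div_const c)
    refine not_tendsto_nhds_of_tendsto_atTop ?_ _ hlim
    refine tendsto_atTop_mono' _ ?_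
      (tendsto_atTop_add_const_left atTop (φ X) (tendsto_id.atTop_div_const (show (0 : ℝ) < 4 by norm_num)))
    filter_upwards [eventually_ge_atTop X] with x hx
    have := hmono (mem_Ici.2 le_rfl) hx hx
    simp only [hφ, id] at this ⊢
    linarith
  set r := w₂ X / w₁ X with hrdef
  have hwX := hw0 X le_rfl
  have hall : ∀ x, 0 < x → w₂ x = r * w₁ x := by
    intro x hx
    refine linear_ode_unique (g := fun x => r * w₁ x) (g' := fun x => r * d₁ x) hqc hd₂
      (fun y hy => ⟨(hd₁ y hy).1.const_mul r, ?_⟩) hX0 ?_ ?_ hx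
    · exact ((hd₁ y hy).2.const_mul r).congr_deriv (by simp only [hq]; ring)
    · rw [hrdef]; field_simp
    · have := hc X hX0
      rw [hc0] at this
      rw [hrdef]
      field_simp
      linear_combination this
  have hr1 : r = 1 := by
    refine tendsto_nhds_unique ?_ hr
    refine tendsto_const_nhds.congr' ?_
    filter_upwards [eventually_ge_atTop X] with y hy
    rw [hall y (hX0.trans_le hy), mul_div_cancel_right₀ _ (hw0 y hy)]
  rw [hall x hx, hr1, one_mul]

theorem whittakerW_one_eq (b : ℂ) {x : ℝ} (hx : 0 < x) :
    whittakerW 1 b x = Complex.exp (-(x : ℂ) / 2) * whittakerSeries (b ^ 2 - 1 / 4) x := by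
  have h : ∃ w : ℝ → ℂ, IsWhittakerW 1 b w := ⟨_, isWhittakerW_one b⟩
  rw [whittakerW, dif_pos h]
  exact h.choose_spec.unique (isWhittakerW_one b) hx

/-! ### Taylor expansion in `b` at `1 / 2` -/

/-- The term `0 * (b - p) ^ 3` keeps the derivative in the same form, so the lemma can be iterated.
-/
theorem deriv_poly_add_pow_mul {c₀ c₁ c₂ c₃ p : ℂ} {m : ℕ} {K : ℂ → ℂ} (hK : Differentiable ℂ K) :
    deriv (fun b : ℂ => c₀ + c₁ * (b - p) + c₂ * (b - p) ^ 2 + c₃ * (b - p) ^ 3 +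
      (b - p) ^ (m + 1) * K b) = fun b => c₁ + 2 * c₂ * (b - p) + 3 * c₃ * (b - p) ^ 2 +
      0 * (b - p) ^ 3 + (b - p) ^ m * ((m + 1) * K b + (b - p) * deriv K b) := by
  ext b
  have h0 : HasDerivAt (fun b : ℂ => b - p) 1 b := (hasDerivAt_id b).sub_const p
  have h := ((((hasDerivAt_const b c₀).fun_add (h0.const_mul c₁)).fun_add
    ((h0.fun_pow 2).const_mul c₂)).fun_add ((h0.fun_pow 3).const_mul c₃)).fun_add
    ((h0.fun_pow (m + 1)).fun_mul (hK b).hasDerivAt)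
  rw [h.deriv]
  push_cast
  ring

theorem differentiable_next {K : ℂ → ℂ} (hK : Differentiable ℂ K) (p c : ℂ) :
    Differentiable ℂ fun b => c * K b + (b - p) * deriv K b := by
  have : Differentiable ℂ (deriv K) := hK.deriv
  fun_prop

theorem iteratedDeriv_cubic_add {c₀ c₁ c₂ c₃ p : ℂ} {K : ℂ → ℂ} (hK : Differentiable ℂ K) :
    let f := fun b : ℂ => c₀ + c₁ * (b - p) + c₂ * (b - p) ^ 2 + c₃ * (b - p) ^ 3 +
      (b - p) ^ 4 * K b
    iteratedDeriv 1 f p = c₁ ∧ iteratedDeriv 2 f p = 2 * c₂ ∧ iteratedDeriv 3 f p = 6 * c₃ := by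
  intro f
  have e1 := deriv_poly_add_pow_mul (c₀ := c₀) (c₁ := c₁) (c₂ := c₂) (c₃ := c₃) (p := p) (m := 3) hK
  have hK1 := differentiable_next hK p (((3 : ℕ) : ℂ) + 1)
  have e2 := deriv_poly_add_pow_mul (c₀ := c₁) (c₁ := 2 * c₂) (c₂ := 3 * c₃) (c₃ := 0) (p := p)
    (m := 2) hK1
  have hK2 := differentiable_next hK1 p (((2 : ℕ) : ℂ) + 1)
  have e3 := deriv_poly_add_pow_mul (c₀ := 2 * c₂) (c₁ := 2 * (3 * c₃)) (c₂ := 3 * 0) (c₃ := 0)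
    (p := p) (m := 1) hK2
  refine ⟨?_, ?_, ?_⟩
  · rw [iteratedDeriv_one, e1]; simp
  · rw [iteratedDeriv_succ', iteratedDeriv_one, e1, e2]; simp
  · rw [iteratedDeriv_succ', iteratedDeriv_succ', iteratedDeriv_one, e1, e2, e3]
    simp
    ring

/-- The series `∑ λ ^ j * higherCoeff (j + 1) x`. -/
noncomputable def higherTail (x : ℝ) (l : ℂ) : ℂ := ∑' j : ℕ, l ^ j * (higherCoeff (j + 1) x : ℂ)

theorem higherSum_eq (l : ℂ) {x : ℝ} (hx : 0 < x) :
    higherSum l x = coeffThree x + l * higherTail x l := by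
  rw [higherSum, (summable_higherSum l hx).tsum_eq_zero_add, higherTail, ← tsum_mul_left]
  simp [higherCoeff, pow_succ', mul_assoc]

theorem differentiable_higherTail {x : ℝ} (hx : 0 < x) : Differentiable ℂ (higherTail x) := by
  intro l
  set r := ‖l‖ + 1 with hr
  have hr0 : 0 < r := by positivity
  have hs : Summable fun j : ℕ => r ^ j * |higherCoeff (j + 1) x| := by
    have h : Summable fun j : ℕ => r ^ j * |higherCoeff j x| :=
      .of_nonneg_of_le (fun j => by positivity) (fun j => by
        gcongr; exact abs_higherCoeff_le j hx) (summable_majorant r 5 x hx 1)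
    have h1 := ((summable_nat_add_iff 1).2 h).mul_left r⁻¹
    refine h1.congr fun j => ?_
    rw [pow_succ]
    field_simp
  have hd : DifferentiableOn ℂ (higherTail x) (Metric.ball 0 r) := by
    refine Complex.differentiableOn_tsum_of_summable_norm hs (fun j => by fun_prop)
      Metric.isOpen_ball fun j z hz => ?_
    rw [norm_mul, norm_pow, Complex.norm_real, Real.norm_eq_abs]
    gcongr
    simpa using (mem_ball_zero_iff.1 hz).le
  exact hd.differentiableAt (Metric.isOpen_ball.mem_nhds (by simp [hr]))

/-- The remainder in the cubic Taylor expansion of `exp (x / 2) * W_{1,b}(x)` at `b = 1 / 2`. -/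
noncomputable def taylorRemainder (x : ℝ) (b : ℂ) : ℂ :=
  coeffTwo x + (3 + 3 * (b - 1 / 2) + (b - 1 / 2) ^ 2) * coeffThree x +
    (b + 1 / 2) ^ 4 * higherTail x (b ^ 2 - 1 / 4)

theorem differentiable_taylorRemainder {x : ℝ} (hx : 0 < x) :
    Differentiable ℂ (taylorRemainder x) := by
  have h : Differentiable ℂ fun b : ℂ => higherTail x (b ^ 2 - 1 / 4) :=
    (differentiable_higherTail hx).comp (by fun_prop)
  unfold taylorRemainder
  fun_prop

/-- With `t = b - 1 / 2`, `λ = t + t ^ 2`, so `t ^ 2` has coefficient `1 + u_2` and `t ^ 3` has `2 *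
u_2 + u_3`, which is `L`. -/
theorem whittakerW_one_taylor {x : ℝ} (hx : 0 < x) : (fun b : ℂ => whittakerW 1 b x) = fun b =>
    Complex.exp (-(x : ℂ) / 2) * x + Complex.exp (-(x : ℂ) / 2) * (b - 1 / 2) +
      Complex.exp (-(x : ℂ) / 2) * (1 + coeffTwo x) * (b - 1 / 2) ^ 2 +
      Complex.exp (-(x : ℂ) / 2) * laplaceLogDiv x * (b - 1 / 2) ^ 3 +
      (b - 1 / 2) ^ 4 * (Complex.exp (-(x : ℂ) / 2) * taylorRemainder x b) := by
  ext b
  have e : (laplaceLogDiv x : ℂ) = coeffThree x + 2 * coeffTwo x := by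
    rw [coeffThree]; push_cast; ring
  rw [whittakerW_one_eq b hx, whittakerSeries, higherSum_eq _ hx, taylorRemainder, e]
  ring

theorem contDiff_whittakerW_one {x : ℝ} (hx : 0 < x) :
    ContDiff ℂ 3 (fun b : ℂ => whittakerW 1 b x) := by
  rw [whittakerW_one_taylor hx]
  have h : ContDiff ℂ 3 (taylorRemainder x) := (differentiable_taylorRemainder hx).contDiff
  fun_prop

theorem iteratedDeriv_whittakerW_one {x : ℝ} (hx : 0 < x) :
    iteratedDeriv 1 (fun b : ℂ => whittakerW 1 b x) (1 / 2) = Complex.exp (-(x : ℂ) / 2) ∧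
    iteratedDeriv 2 (fun b : ℂ => whittakerW 1 b x) (1 / 2) =
      2 * (Complex.exp (-(x : ℂ) / 2) * (1 + coeffTwo x)) ∧
    iteratedDeriv 3 (fun b : ℂ => whittakerW 1 b x) (1 / 2) =
      6 * (Complex.exp (-(x : ℂ) / 2) * laplaceLogDiv x) := by
  rw [whittakerW_one_taylor hx]
  exact iteratedDeriv_cubic_add ((differentiable_taylorRemainder hx).const_mul _)

/-! ### Mellin transforms of Laplace transforms -/

theorem norm_ofReal_cpow_sub_one {x : ℝ} (hx : 0 < x) (s : ℂ) :
    ‖(x : ℂ) ^ (s - 1)‖ = x ^ (s.re - 1) := by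
  rw [Complex.norm_cpow_eq_rpow_re_of_pos hx, Complex.sub_re, Complex.one_re]

theorem integrableOn_cpow_mul_exp_neg_mul {s : ℂ} (hs : 0 < s.re) {y : ℝ} (hy : 0 < y) :
    IntegrableOn (fun x : ℝ => (x : ℂ) ^ (s - 1) * Complex.exp (-(y * x))) (Ioi 0) := by
  by_contra h
  have h1 := Complex.integral_cpow_mul_exp_neg_mul_Ioi hs hy
  rw [integral_undef h] at h1
  have hyc : (1 / y : ℂ) ≠ 0 := one_div_ne_zero (by exact_mod_cast hy.ne')
  exact mul_ne_zero (by simp [Complex.cpow_eq_zero_iff, hy.ne']) (Complex.Gamma_ne_zero_of_re_pos hs)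
    h1.symm

theorem inv_cpow_eq {y : ℝ} (hy : 0 < y) (s : ℂ) : (1 / (y : ℂ)) ^ s = (y : ℂ) ^ (1 - s - 1) := by
  rw [one_div, Complex.inv_cpow _ _ (by rw [Complex.arg_ofReal_of_nonneg hy.le]; exact Real.pi_pos.ne),
    ← Complex.cpow_neg]
  ring_nf

section Laplace

variable {g : ℝ → ℝ} {s : ℂ}

/-- Integrating the norm over `x` first gives `Γ(Re s) * y ^ (-Re s) * |g y|`, integrable by the
Mellin hypothesis on `g`. This justifies Fubini. -/
theorem integrable_laplace_kernel (hs : 0 < s.re) (hgm : ContinuousOn g (Ioi 0))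
    (hg : MellinConvergent (fun y => (g y : ℂ)) (1 - s)) :
    Integrable (fun p : ℝ × ℝ => (p.1 : ℂ) ^ (s - 1) * Complex.exp (-(p.2 * p.1)) * (g p.2 : ℂ))
      ((volume.restrict (Ioi 0)).prod (volume.restrict (Ioi 0))) := by
  have hm : AEStronglyMeasurable
      (fun p : ℝ × ℝ => (p.1 : ℂ) ^ (s - 1) * Complex.exp (-(p.2 * p.1)) * (g p.2 : ℂ))
      ((volume.restrict (Ioi 0)).prod (volume.restrict (Ioi 0))) := by
    refine AEStronglyMeasurable.mul (Measurable.aestronglyMeasurable (by fun_prop)) ?_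
    exact (Complex.continuous_ofReal.comp_aestronglyMeasurable
      (hgm.aestronglyMeasurable measurableSet_Ioi)).comp_snd
  rw [integrable_prod_iff' hm]
  constructor
  · filter_upwards [ae_restrict_mem measurableSet_Ioi] with y hy
    exact (integrableOn_cpow_mul_exp_neg_mul hs hy).mul_const _
  · refine (hg.norm.const_mul (Real.Gamma s.re)).congr ?_
    filter_upwards [ae_restrict_mem measurableSet_Ioi] with y hy
    have hy : 0 < y := hy
    have e : ∫ x in Ioi (0 : ℝ), ‖(x : ℂ) ^ (s - 1) * Complex.exp (-(y * x)) * (g y : ℂ)‖ =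
        ∫ x in Ioi (0 : ℝ), x ^ (s.re - 1) * Real.exp (-(y * x)) * ‖(g y : ℂ)‖ := by
      refine setIntegral_congr_fun measurableSet_Ioi fun x hx => ?_
      have e1 : Complex.exp (-((y : ℂ) * x)) = ((Real.exp (-(y * x)) : ℝ) : ℂ) := by push_cast; rfl
      simp only [norm_mul]
      rw [norm_ofReal_cpow_sub_one hx, e1, Complex.norm_real, Real.norm_eq_abs,
        abs_of_pos (Real.exp_pos _)]
    rw [e, integral_mul_const, Real.integral_rpow_mul_exp_neg_mul_Ioi hs hy, norm_smul,
      norm_ofReal_cpow_sub_one hy, one_div, Real.inv_rpow hy.le, ← Real.rpow_neg hy.le]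
    simp only [Complex.sub_re, Complex.one_re]
    ring_nf

theorem integral_laplace_kernel {x : ℝ} :
    ∫ y in Ioi (0 : ℝ), (x : ℂ) ^ (s - 1) * Complex.exp (-(y * x)) * (g y : ℂ) =
    (x : ℂ) ^ (s - 1) • ((∫ y in Ioi (0 : ℝ), Real.exp (-(x * y)) * g y : ℝ) : ℂ) := by
  rw [← integral_complex_ofReal, smul_eq_mul, ← integral_const_mul]
  refine integral_congr_ae (.of_forall fun y => ?_)
  push_cast
  ring_nf

theorem mellinConvergent_laplace (hs : 0 < s.re) (hgm : ContinuousOn g (Ioi 0))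
    (hg : MellinConvergent (fun y => (g y : ℂ)) (1 - s)) :
    MellinConvergent (fun x => ((∫ y in Ioi (0 : ℝ), Real.exp (-(x * y)) * g y : ℝ) : ℂ)) s := by
  have h := (integrable_laplace_kernel hs hgm hg).integral_prod_left
  simp only [integral_laplace_kernel] at h
  exact h

theorem mellin_laplace (hs : 0 < s.re) (hgm : ContinuousOn g (Ioi 0))
    (hg : MellinConvergent (fun y => (g y : ℂ)) (1 - s)) :
    mellin (fun x => ((∫ y in Ioi (0 : ℝ), Real.exp (-(x * y)) * g y : ℝ) : ℂ)) s =
      Complex.Gamma s * mellin (fun y => (g y : ℂ)) (1 - s) := by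
  have h := integral_integral_swap
    (f := fun x y : ℝ => (x : ℂ) ^ (s - 1) * Complex.exp (-(y * x)) * (g y : ℂ))
    (integrable_laplace_kernel hs hgm hg)
  simp only [integral_laplace_kernel] at h
  rw [mellin, h, mellin, ← integral_const_mul]
  refine setIntegral_congr_fun measurableSet_Ioi fun y hy => ?_
  rw [integral_mul_const, Complex.integral_cpow_mul_exp_neg_mul_Ioi hs hy, inv_cpow_eq hy,
    smul_eq_mul]
  ring

end Laplace

theorem hasMellin_exp_neg {s : ℂ} (hs : 0 < s.re) :
    HasMellin (fun x => ((Real.exp (-x) : ℝ) : ℂ)) s (Complex.Gamma s) := by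
  refine ⟨?_, ?_⟩
  · refine (Complex.GammaIntegral_convergent hs).congr_fun (fun x _ => ?_) measurableSet_Ioi
    simp [mul_comm]
  · rw [Complex.Gamma_eq_integral hs, Complex.GammaIntegral_eq_mellin]

/-- `1 / (1 + x)` is the Laplace transform of `exp (-y)`, whose Mellin transform is `Γ`. -/
theorem hasMellin_inv_one_add {s : ℂ} (h0 : 0 < s.re) (h1 : s.re < 1) :
    HasMellin (fun x : ℝ => ((1 / (1 + x) : ℝ) : ℂ)) s
      (Complex.Gamma s * Complex.Gamma (1 - s)) := by
  have h1' : 0 < (1 - s).re := by simpa using h1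
  have hc : ContinuousOn (fun x : ℝ => Real.exp (-x)) (Ioi 0) := by fun_prop
  have hE := hasMellin_exp_neg h1'
  have e : ∀ x ∈ Ioi (0 : ℝ), ((∫ y in Ioi (0 : ℝ), Real.exp (-(x * y)) * Real.exp (-y) : ℝ) : ℂ) =
      ((1 / (1 + x) : ℝ) : ℂ) := by
    intro x hx
    have hx : 0 < x := hx
    rw [← integral_Ioi_exp_neg_mul (show 0 < 1 + x by positivity)]
    congr 2
    ext y
    rw [← Real.exp_add]
    ring_nf
  refine ⟨(mellinConvergent_laplace h0 hc hE.1).congr_fun (fun x hx => ?_) measurableSet_Ioi, ?_⟩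
  · simp only [e x hx]
  · rw [← hE.2, ← mellin_laplace h0 hc hE.1]
    refine setIntegral_congr_fun measurableSet_Ioi fun x hx => ?_
    simp only [e x hx]

theorem log_one_add_le_rpow {δ y : ℝ} (hδ : 0 < δ) (hy : 1 ≤ y) :
    Real.log (1 + y) ≤ 2 ^ δ / δ * y ^ δ := by
  calc Real.log (1 + y) ≤ (1 + y) ^ δ / δ := Real.log_le_rpow_div (by linarith) hδ
    _ ≤ (2 * y) ^ δ / δ := by gcongr; linarith
    _ = 2 ^ δ / δ * y ^ δ := by rw [Real.mul_rpow two_pos.le (by linarith)]; ring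

/-- The function is bounded near 0 and `O(y ^ (s.re / 2 - 1))` at infinity; any exponent strictly
between 0 and `s.re` would do for the logarithm. -/
theorem mellinConvergent_log_one_add_div {s : ℂ} (h0 : 0 < s.re) (h1 : s.re < 1) :
    MellinConvergent (fun y : ℝ => ((Real.log (1 + y) / y : ℝ) : ℂ)) (1 - s) := by
  have hδ : 0 < s.re / 2 := by positivity
  refine mellinConvergent_of_isBigO_rpow (a := 1 - s.re / 2) (b := 0) ?_ ?_ ?_ ?_ ?_
  · exact (Complex.continuous_ofReal.comp_continuousOn
      continuousOn_log_one_add_div).locallyIntegrableOn measurableSet_Ioi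
  · refine Asymptotics.IsBigO.of_bound (2 ^ (s.re / 2) / (s.re / 2)) ?_
    filter_upwards [eventually_ge_atTop 1] with y hy
    have hy0 : 0 < y := one_pos.trans_le hy
    rw [Complex.norm_real, Real.norm_eq_abs, abs_of_nonneg (log_one_add_div_bounds hy0).2.2,
      Real.norm_eq_abs, abs_of_nonneg (by positivity), div_le_iff₀ hy0]
    refine (log_one_add_le_rpow hδ hy).trans (le_of_eq ?_)
    rw [mul_assoc]
    congr 1
    nth_rewrite 3 [← Real.rpow_one y]
    rw [← Real.rpow_add hy0]
    ring_nf
  · simp only [Complex.sub_re, Complex.one_re]; linarith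
  · refine Asymptotics.IsBigO.of_bound 1 ?_
    filter_upwards [self_mem_nhdsWithin] with y hy
    obtain ⟨-, h, h'⟩ := log_one_add_div_bounds hy
    rw [Complex.norm_real, Real.norm_eq_abs, abs_of_nonneg h']
    simpa using h
  · simpa using h1

/-- Integrating by parts against `y ^ (-s) / (-s)` replaces the logarithm by `1 / (1 + y)`; both
boundary terms vanish because `0 < s.re < 1`. -/
theorem mellin_log_one_add_div {s : ℂ} (h0 : 0 < s.re) (h1 : s.re < 1) :
    mellin (fun y : ℝ => ((Real.log (1 + y) / y : ℝ) : ℂ)) (1 - s) =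
      Complex.Gamma s * Complex.Gamma (1 - s) / s := by
  have hs0 : s ≠ 0 := by rintro rfl; simp at h0
  have h1' : 0 < (1 - s).re := by simpa using h1
  have hI := hasMellin_inv_one_add h1' (by simpa using h0)
  rw [sub_sub_cancel] at hI
  have hu : ∀ y ∈ Ioi (0 : ℝ), HasDerivAt (fun y : ℝ => ((Real.log (1 + y) : ℝ) : ℂ))
      ((1 / (1 + y) : ℝ) : ℂ) y := fun y hy => by
    have hy : 0 < y := hy
    exact (((hasDerivAt_id y).const_add 1).log (by simp only [id]; positivity)).ofReal_comp
  have hv : ∀ y ∈ Ioi (0 : ℝ), HasDerivAt (fun y : ℝ => (y : ℂ) ^ (-s) / (-s))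
      ((y : ℂ) ^ (-s - 1)) y := fun y hy => by
    have h := (hasDerivAt_ofReal_cpow_const (x := y) (r := -s) (ne_of_gt hy)
      (neg_ne_zero.2 hs0)).div_const (-s)
    exact h.congr_deriv (mul_div_cancel_left₀ _ (neg_ne_zero.2 hs0))
  have hnorm : ∀ y : ℝ, 0 < y → ‖((Real.log (1 + y) : ℝ) : ℂ) * ((y : ℂ) ^ (-s) / (-s))‖ =
      Real.log (1 + y) * y ^ (-s.re) / ‖s‖ := fun y hy => by
    rw [norm_mul, norm_div, norm_neg, Complex.norm_cpow_eq_rpow_re_of_pos hy, Complex.norm_real,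
      Real.norm_eq_abs, abs_of_nonneg (Real.log_nonneg (by linarith)), Complex.neg_re]
    ring
  have hz : Tendsto ((fun y : ℝ => ((Real.log (1 + y) : ℝ) : ℂ)) * fun y : ℝ => (y : ℂ) ^ (-s) / (-s))
      (𝓝[>] 0) (𝓝 0) := by
    have hlim : Tendsto (fun y : ℝ => y ^ (1 - s.re) / ‖s‖) (𝓝[>] 0) (𝓝 0) := by
      have h := ((Real.continuousAt_rpow_const 0 (1 - s.re) (Or.inr (by linarith))).tendsto.div_const
        ‖s‖).mono_left (nhdsWithin_le_nhds (s := Ioi (0 : ℝ)))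
      rwa [Real.zero_rpow (by linarith), zero_div] at h
    refine squeeze_zero_norm' ?_ hlim
    filter_upwards [self_mem_nhdsWithin] with y hy
    have hy : 0 < y := hy
    rw [Pi.mul_apply, hnorm y hy, sub_eq_add_neg, Real.rpow_add hy, Real.rpow_one]
    gcongr
    exact log_one_add_le_self hy
  have ht : Tendsto ((fun y : ℝ => ((Real.log (1 + y) : ℝ) : ℂ)) * fun y : ℝ => (y : ℂ) ^ (-s) / (-s))
      atTop (𝓝 0) := by
    have hδ : 0 < s.re / 2 := by positivity
    have hlim : Tendsto (fun y : ℝ => 2 ^ (s.re / 2) / (s.re / 2) * y ^ (-(s.re / 2)) / ‖s‖)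
        atTop (𝓝 0) := by
      have h := ((tendsto_rpow_neg_atTop hδ).const_mul (2 ^ (s.re / 2) / (s.re / 2))).div_const ‖s‖
      rwa [mul_zero, zero_div] at h
    refine squeeze_zero_norm' ?_ hlim
    filter_upwards [eventually_ge_atTop 1] with y hy
    have hy0 : 0 < y := one_pos.trans_le hy
    have e : y ^ (-(s.re / 2)) = y ^ (s.re / 2) * y ^ (-s.re) := by
      rw [← Real.rpow_add hy0]; ring_nf
    rw [Pi.mul_apply, hnorm y hy0, e, ← mul_assoc]
    gcongr
    exact log_one_add_le_rpow hδ hy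
  have e1 : EqOn (fun y : ℝ => (y : ℂ) ^ (1 - s - 1) • ((Real.log (1 + y) / y : ℝ) : ℂ))
      ((fun y : ℝ => ((Real.log (1 + y) : ℝ) : ℂ)) * fun y : ℝ => (y : ℂ) ^ (-s - 1)) (Ioi 0) := by
    intro y hy
    have hyc : (y : ℂ) ≠ 0 := by exact_mod_cast (ne_of_gt hy)
    simp only [Pi.mul_apply, smul_eq_mul]
    rw [sub_sub_cancel_left, Complex.cpow_sub _ 1 hyc, Complex.cpow_one]
    push_cast
    ring
  have e2 : EqOn (fun y : ℝ => (y : ℂ) ^ (1 - s - 1) • ((1 / (1 + y) : ℝ) : ℂ) / (-s))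
      ((fun y : ℝ => ((1 / (1 + y) : ℝ) : ℂ)) * fun y : ℝ => (y : ℂ) ^ (-s) / (-s)) (Ioi 0) := by
    intro y hy
    simp only [Pi.mul_apply, smul_eq_mul, sub_sub_cancel_left]
    ring
  have hparts := integral_Ioi_mul_deriv_eq_deriv_mul hu hv
    ((mellinConvergent_log_one_add_div h0 h1).congr_fun e1 measurableSet_Ioi)
    (IntegrableOn.congr_fun (Integrable.div_const hI.1 (-s)) e2 measurableSet_Ioi) hz ht
  have h3 := setIntegral_congr_fun (μ := volume) measurableSet_Ioi e1
  have h4 := setIntegral_congr_fun (μ := volume) measurableSet_Ioi e2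
  rw [integral_div] at h4
  simp only [Pi.mul_apply] at h3 h4
  have h5 := hI.2
  rw [mellin] at h5 ⊢
  rw [h3, hparts, ← h4, h5]
  field_simp
  ring

theorem laplaceLogDiv_eq : laplaceLogDiv =
    fun x => ∫ y in Ioi (0 : ℝ), Real.exp (-(x * y)) * (Real.log (1 + y) / y) := by
  ext x
  simp only [laplaceLogDiv, mul_div_assoc]

theorem hasMellin_laplaceLogDiv {s : ℂ} (h0 : 0 < s.re) (h1 : s.re < 1) :
    HasMellin (fun x => (laplaceLogDiv x : ℂ)) s
      (Complex.Gamma s * (Complex.Gamma s * Complex.Gamma (1 - s) / s)) := by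
  have h := mellinConvergent_log_one_add_div h0 h1
  rw [laplaceLogDiv_eq]
  refine ⟨mellinConvergent_laplace h0 continuousOn_log_one_add_div h, ?_⟩
  rw [mellin_laplace h0 continuousOn_log_one_add_div h, mellin_log_one_add_div h0 h1]

/-! ### Mellin inversion and the Meijer function -/

theorem norm_Gamma_le_of_re {s : ℂ} (hs : 0 < s.re) : ‖Complex.Gamma s‖ ≤ Real.Gamma s.re := by
  rw [Complex.Gamma_eq_integral hs, Complex.GammaIntegral, Real.Gamma_eq_integral hs]
  refine norm_integral_le_of_norm_le (Real.GammaIntegral_convergent hs) ?_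
  filter_upwards [ae_restrict_mem measurableSet_Ioi] with x hx
  rw [norm_mul, norm_ofReal_cpow_sub_one hx, Complex.norm_real, Real.norm_eq_abs,
    abs_of_pos (Real.exp_pos _)]

theorem one_add_sq_div_four_le_cosh (t : ℝ) : 1 + t ^ 2 / 4 ≤ Real.cosh t := by
  rw [← Real.cosh_abs, ← sq_abs, Real.cosh_eq]
  have h1 := Real.quadratic_le_exp_of_nonneg (abs_nonneg t)
  have h2 := Real.add_one_le_exp (-|t|)
  linarith

theorem sin_mul_le_norm_sin (a b : ℝ) (ha : 0 ≤ Real.sin a) :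
    Real.sin a * (1 + b ^ 2 / 4) ≤ ‖Complex.sin (a + b * Complex.I)‖ := by
  refine le_trans ?_ ((le_abs_self _).trans (Complex.abs_re_le_norm _))
  have : (Complex.sin (a + b * Complex.I)).re = Real.sin a * Real.cosh b := by
    rw [Complex.sin_add_mul_I, ← Complex.ofReal_sin, ← Complex.ofReal_cosh, ← Complex.ofReal_cos,
      ← Complex.ofReal_sinh]
    simp only [← Complex.ofReal_mul, Complex.add_re, Complex.re_ofReal_mul, Complex.ofReal_re,
      Complex.I_re, mul_zero, add_zero]
  rw [this]
  exact mul_le_mul_of_nonneg_left (one_add_sq_div_four_le_cosh b) ha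

/-- By reflection `Γ(s) * Γ(1 - s) = π / sin (π s)`, and the sine grows on vertical lines. A
quadratic lower bound suffices, the other factors being bounded. -/
theorem verticalIntegrable_mellin_laplaceLogDiv {σ : ℝ} (h0 : 0 < σ) (h1 : σ < 1) :
    Complex.VerticalIntegrable (mellin fun x => (laplaceLogDiv x : ℂ)) σ := by
  have hre : ∀ t : ℝ, ((σ : ℂ) + t * Complex.I).re = σ := fun t => by simp
  have hsin : 0 < Real.sin (Real.pi * σ) :=
    Real.sin_pos_of_pos_of_lt_pi (by positivity) (by nlinarith [Real.pi_pos])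
  have hform : ∀ t : ℝ, mellin (fun x => (laplaceLogDiv x : ℂ)) (σ + t * Complex.I) =
      Complex.Gamma (σ + t * Complex.I) * (Complex.Gamma (σ + t * Complex.I) *
        Complex.Gamma (1 - (σ + t * Complex.I)) / (σ + t * Complex.I)) := fun t =>
    (hasMellin_laplaceLogDiv (by rwa [hre]) (by rwa [hre])).2
  unfold Complex.VerticalIntegrable
  simp only [hform]
  have hne : ∀ t : ℝ, (σ : ℂ) + t * Complex.I ≠ 0 := fun t h => by
    have := hre t
    rw [h] at this
    simp at this
    exact h0.ne this
  refine Integrable.mono' (integrable_inv_one_add_sq.const_mul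
    (Real.Gamma σ * (Real.pi / Real.sin (Real.pi * σ) / σ))) ?_ ?_
  · refine Continuous.aestronglyMeasurable ?_
    have hl : Continuous fun t : ℝ => (σ : ℂ) + t * Complex.I := by fun_prop
    have hG : ∀ s : ℂ, 0 < s.re → ContinuousAt Complex.Gamma s := fun s hs =>
      (Complex.differentiableAt_Gamma s fun m h => by
        rw [h] at hs
        simp at hs
        have : (0 : ℝ) ≤ m := m.cast_nonneg
        linarith).continuousAt
    have hc1 : Continuous fun t : ℝ => Complex.Gamma (σ + t * Complex.I) :=
      continuous_iff_continuousAt.2 fun t =>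
        ContinuousAt.comp (hG _ (by rwa [hre])) hl.continuousAt
    have hc2 : Continuous fun t : ℝ => Complex.Gamma (1 - (σ + t * Complex.I)) :=
      continuous_iff_continuousAt.2 fun t =>
        ContinuousAt.comp (f := fun t : ℝ => 1 - ((σ : ℂ) + t * Complex.I))
          (hG _ (by rw [Complex.sub_re, hre, Complex.one_re]; linarith))
          (by fun_prop)
    exact hc1.mul ((hc1.mul hc2).div hl hne)
  · refine .of_forall fun t => ?_
    have e : (Real.pi : ℂ) * (σ + t * Complex.I) =
        ((Real.pi * σ : ℝ) : ℂ) + ((Real.pi * t : ℝ) : ℂ) * Complex.I := by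
      push_cast; ring
    rw [Complex.Gamma_mul_Gamma_one_sub, norm_mul, norm_div, norm_div, Complex.norm_real,
      Real.norm_eq_abs, abs_of_pos Real.pi_pos, e, mul_assoc, div_mul_eq_mul_div]
    have hG : ‖Complex.Gamma (σ + t * Complex.I)‖ ≤ Real.Gamma σ := by
      have := norm_Gamma_le_of_re (s := σ + t * Complex.I) (by rwa [hre])
      rwa [hre] at this
    have hs : σ ≤ ‖(σ : ℂ) + t * Complex.I‖ := by
      have := (le_abs_self _).trans (Complex.abs_re_le_norm ((σ : ℂ) + t * Complex.I))
      rwa [hre] at this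
    have hS : Real.sin (Real.pi * σ) * (1 + t ^ 2) ≤
        ‖Complex.sin (((Real.pi * σ : ℝ) : ℂ) + ((Real.pi * t : ℝ) : ℂ) * Complex.I)‖ := by
      refine le_trans ?_ (sin_mul_le_norm_sin _ _ hsin.le)
      gcongr
      have h3 : 4 ≤ Real.pi ^ 2 := by nlinarith [Real.pi_gt_three]
      rw [mul_pow]
      nlinarith [sq_nonneg t]
    have hpos : 0 < Real.sin (Real.pi * σ) * (1 + t ^ 2) := by positivity
    have hΓ : 0 < Real.Gamma σ := Real.Gamma_pos_of_pos h0
    calc _ ≤ Real.Gamma σ * (Real.pi / (Real.sin (Real.pi * σ) * (1 + t ^ 2)) / σ) := by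
          gcongr
      _ = _ := by field_simp

theorem mellinInv_mellin_laplaceLogDiv {σ x : ℝ} (h0 : 0 < σ) (h1 : σ < 1) (hx : 0 < x) :
    mellinInv σ (mellin fun x => (laplaceLogDiv x : ℂ)) x = laplaceLogDiv x :=
  mellinInv_mellin_eq σ _ hx (hasMellin_laplaceLogDiv (by simpa) (by simpa)).1
    (verticalIntegrable_mellin_laplaceLogDiv h0 h1)
    (Complex.continuous_ofReal.continuousAt.comp (hasDerivAt_laplaceLogDiv hx).continuousAt)

/-- With `Γ(1 + z) = z * Γ(z)`, one of the three factors `Γ(z)` cancels. -/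
theorem meijerIntegrand_eq_mellin {x : ℝ} {z : ℂ} (h0 : 0 < z.re) (h1 : z.re < 1) :
    meijerIntegrand 3 1 ![0, 1] ![0, 0, 0] x (-z) =
      (x : ℂ) ^ (-z) * mellin (fun x => (laplaceLogDiv x : ℂ)) z := by
  have hz : z ≠ 0 := by rintro rfl; simp at h0
  have e1 : (Finset.univ.filter fun k : Fin 3 => k.val < 3) = Finset.univ := by decide
  have e2 : (Finset.univ.filter fun j : Fin 2 => j.val < 1) = {0} := by decide
  have e3 : (Finset.univ.filter fun k : Fin 3 => 3 ≤ k.val) = ∅ := by decide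
  have e4 : (Finset.univ.filter fun j : Fin 2 => 1 ≤ j.val) = {1} := by decide
  have hG : Complex.Gamma (1 + z) = z * Complex.Gamma z := by
    rw [add_comm, Complex.Gamma_add_one z hz]
  have hG0 : Complex.Gamma z ≠ 0 := Complex.Gamma_ne_zero_of_re_pos h0
  rw [(hasMellin_laplaceLogDiv h0 h1).2, meijerIntegrand, e1, e2, e3, e4]
  simp [Fin.prod_univ_three, ← sub_eq_add_neg, hG]
  field_simp

theorem meijerG_eq_laplaceLogDiv {x : ℝ} (hx : 0 < x) :
    meijerG 3 1 ![0, 1] ![0, 0, 0] (x : ℂ) = laplaceLogDiv x := by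
  have h : ∃ σ : ℝ, IsMeijerAbscissa 3 1 (![0, 1] : Fin 2 → ℂ) (![0, 0, 0] : Fin 3 → ℂ) σ := by
    refine ⟨-1 / 2, fun k _ => ?_, fun j hj => ?_⟩
    · fin_cases k <;> norm_num
    · fin_cases j
      · norm_num
      · simp at hj
  rw [meijerG, dif_pos h]
  -- Of the chosen abscissa only `-1 < σ < 0` is known, and inversion works on every such line.
  obtain ⟨hs1, hs2⟩ := h.choose_spec
  set σ := h.choose
  have hσ0 : 0 < -σ := by simpa using hs1 0 (by norm_num)
  have hσ1 : -σ < 1 := by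
    have := hs2 0 (by norm_num)
    simp at this
    linarith
  -- Mellin inversion runs along `Re z = -σ` with `z = -s`, hence the reflection `t ↦ -t`.
  rw [← mellinInv_mellin_laplaceLogDiv hσ0 hσ1 hx, mellinInv, integral_mul_const,
    ← integral_neg_eq_self]
  have e : ∀ t : ℝ, meijerIntegrand 3 1 ![0, 1] ![0, 0, 0] (x : ℂ) (σ + ((-t : ℝ) : ℂ) * Complex.I) =
      (x : ℂ) ^ (-(((-σ : ℝ) : ℂ) + t * Complex.I)) •
        mellin (fun x => (laplaceLogDiv x : ℂ)) (((-σ : ℝ) : ℂ) + t * Complex.I) := fun t => by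
    rw [smul_eq_mul, ← meijerIntegrand_eq_mellin (by simpa using hσ0) (by simpa using hσ1)]
    congr 1
    push_cast
    ring
  simp only [e]
  rw [Complex.real_smul]
  push_cast
  field_simp [Complex.I_ne_zero]

theorem lemma3p4 (x : ℝ) (hx : 0 < x) :
    ContDiffAt ℂ 3 (fun b : ℂ => whittakerW 1 b x) (1 / 2) ∧
    iteratedDeriv 1 (fun b : ℂ => whittakerW 1 b x) (1 / 2) = Complex.exp (-(x : ℂ) / 2) ∧
    iteratedDeriv 2 (fun b : ℂ => whittakerW 1 b x) (1 / 2) =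
      2 * Complex.exp (-(x : ℂ) / 2) *
        (Complex.exp (x : ℂ) * (expIntegralE1 x : ℂ) +
          (x : ℂ) * meijerG 3 1 ![0, 1] ![0, 0, 0] (x : ℂ)) ∧
    iteratedDeriv 3 (fun b : ℂ => whittakerW 1 b x) (1 / 2) =
      6 * Complex.exp (-(x : ℂ) / 2) * meijerG 3 1 ![0, 1] ![0, 0, 0] (x : ℂ) ∧
    MeasureTheory.IntegrableOn (fun y : ℝ => Real.exp (-(x * y)) * Real.log (1 + y) / y)
      (Set.Ioi 0) ∧
    meijerG 3 1 ![0, 1] ![0, 0, 0] (x : ℂ) =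
      ((∫ y in Set.Ioi (0 : ℝ), Real.exp (-(x * y)) * Real.log (1 + y) / y : ℝ) : ℂ) := by
  obtain ⟨h1, h2, h3⟩ := iteratedDeriv_whittakerW_one hx
  have hG := meijerG_eq_laplaceLogDiv hx
  refine ⟨(contDiff_whittakerW_one hx).contDiffAt, h1, ?_, ?_, integrableOn_exp_mul_log_div hx, hG⟩
  · rw [h2, hG, coeffTwo, expMulE1]
    push_cast
    ring
  · rw [h3, hG]
    ring
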